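/- **Setting.** Let $\alpha>-\tfrac12$, $l>0$, $n\in\mathbb{Z}_0^+$. Let $G_m^{(\alpha)}$ be the Gegenbauer polynomial of degree $m$ standardized by $G_m^{(\alpha)}(1)=1$, i.e. $G_0^{(\alpha)}=1$, $G_1^{(\alpha)}(x)=x$, $(m+2\alpha)G_{m+1}^{(\alpha)}(x)=2(m+\alpha)\,x\,G_m^{(\alpha)}(x)-m\,G_{m-1}^{(\alpha)}(x)$ for $m\ge1$, and let $G_{l,m}^{(\alpha)}(x)=G_m^{(\alpha)}(2x/l-1)$ be the shifted polynomial on $[0,l]$. Let $x_0<x_1<\dots<x_n$ be the zeros of $G_{l,n+1}^{(\alpha)}$ (shifted Gegenbauer–Gauss nodes), and let $\varpi_i$ be the corresponding Christoffel numbers, i.e. the weights of the Gauss quadrature at these nodes for the weight function $(x(l-x))^{\alpha-1/2}$ on $[0,l]$. With the shifted barycentric weights $$\xi_i=2(-1)^i\sqrt{4^{\alpha}\,l^{-2(1+\alpha)}\,(l-x_i)\,x_i\,\varpi_i}$$ define the barycentric Lagrange polynomials $\mathcal L_j(x)=\dfrac{\xi_j}{x-x_j}\Big/\sum_{k=0}^n\dfrac{\xi_k}{x-x_k}$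 (extended continuously to the nodes). For $q\in\mathbb{Z}^+$ the $q$th-order barycentric shifted Gegenbauer integration matrix has entries $$p^{(q)}_{ij}=\frac{(x_i-x_j)^{q-1}}{(q-1)!}\int_0^{x_i}\mathcal L_j(x)\,dx .$$ For $f$ continuous on $[0,l]$ let $I_{q,\tilde x}(f)=\int_0^{\tilde x}\int_0^{\sigma_{q-1}}\cdots\int_0^{\sigma_1}f(\sigma_0)\,d\sigma_0\cdots d\sigma_{q-1}$ be its $q$-fold integral. The $q$th-order barycentric shifted Gegenbauer quadrature (BSGQ) approximates $I_{q,x_i}(f)$ by $\sum_{j=0}^n p^{(q)}_{ij}f(x_j)$; its truncation error at $x_i$ is $$E_{q,l,n}^{(\alpha)}=E_{q,l,n}^{(\alpha)}(x_i)=I_{q,x_i}(f)-\sum_{j=0}^n p^{(q)}_{ij}f(x_j).$$ For real $z$ and $k\in\mathbb{Z}_0^+$ write $\binom zk=\frac{z(z-1)\cdots(z-k+1)}{k!}$. **Theorem.** For every $\alpha>-\tfrac12$ there exist positive constants $D_1^{(\alpha)},D_2^{(\alpha)}$ and a number $N^{(\alpha)}\in\mathbb{Z}_0^+$, depending only on $\alpha$,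 such that the following holds for all $l>0$, $n\in\mathbb{Z}_0^+$, $q\in\mathbb{Z}^+$, $f\in C^{n+1}[0,l]$, $i\in\{0,\dots,n\}$ and $A>0$ with $$\sup_{0<x<l}\left|\frac{d^{n+1}}{dx^{n+1}}\Big((x_i-x)^{q-1}f(x)\Big)\right|\le A .$$ 1. If $\alpha\ge0$, or if $-\frac12<\alpha<0$ and $n$ is odd, then $$\left|E_{q,l,n}^{(\alpha)}\right|\le\frac{A\,2^{-2n-1}\,\Gamma(\alpha+1)\,x_i\,l^{n+1}\,\Gamma(n+2\alpha+1)}{(q-1)!\,\Gamma(2\alpha+1)\,\Gamma(n+2)\,\Gamma(n+\alpha+1)}\cdot\begin{cases}1,&\alpha\ge0,\\[4pt]\dfrac{(n+1)!\,|\Gamma(2\alpha)|}{\Gamma(n+2\alpha+1)}\left|\dbinom{\frac{n+1}2+\alpha-1}{\frac{n+1}2}\right|,&\frac{n+1}2\in\mathbb{Z}^+\ \wedge\ -\frac12<\alpha<0.\end{cases}$$ 2. If $-\frac12<\alpha<0$ and $n$ is even, then $$\left|E_{q,l,n}^{(\alpha)}\right|<\frac{A\,2^{-2n-1}\,|\Gamma(\alpha)|\,|\alpha|\,x_i\,l^{n+1}}{(q-1)!\,\sqrt{(n+1)(2\alpha+n+1)}\;\Gamma(n+\alpha+1)}\left|\binom{\frac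 n2+\alpha}{\frac n2}\right| .$$ 3. With $B_1^{(\alpha)}=A\,D_1^{(\alpha)}$ and $B_2^{(\alpha)}=B_1^{(\alpha)}D_2^{(\alpha)}$, for every $n\ge N^{(\alpha)}$, $$\left|E_{q,l,n}^{(\alpha)}\right|\le\begin{cases}B_1^{(\alpha)}\,\dfrac{e^n\,l^{n+1}\,x_i}{2^{2n+1}\,n^{n+3/2-\alpha}\,(q-1)!},&\alpha\ge0,\\[10pt]B_2^{(\alpha)}\,\dfrac{e^n\,l^{n+1}\,x_i}{2^{2n+1}\,n^{n+3/2}\,(q-1)!},&-\frac12<\alpha<0.\end{cases}$$ -/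

import Mathlib

open scoped Polynomial

noncomputable section

namespace BSGQ

/-- The Gegenbauer polynomial of degree `n` and parameter `α > -1/2`, in the standardization
`G n (1) = 1`, through its three-term recurrence
`(n + 1 + 2α) G (n+2) = 2 (n + 1 + α) X G (n+1) - (n + 1) G n`.
(For `α = 0` these are the Chebyshev polynomials of the first kind.) -/
def gegenbauer (α : ℝ) : ℕ → ℝ[X]
  | 0 => 1
  | 1 => Polynomial.X
  | n + 2 =>
      Polynomial.C (((n : ℝ) + 1 + 2 * α)⁻¹) *
        (Polynomial.C (2 * ((n : ℝ) + 1 + α)) * Polynomial.X * gegenbauer α (n + 1)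
          - Polynomial.C ((n : ℝ) + 1) * gegenbauer α n)

/-- The shifted Gegenbauer polynomial `x ↦ G n (2 x / l - 1)` on `[0, l]`. -/
def shiftedGegenbauer (α l : ℝ) (n : ℕ) : ℝ[X] :=
  (gegenbauer α n).comp (Polynomial.C (2 / l) * Polynomial.X - 1)

/-- The shifted Gegenbauer–Gauss nodes `x 0 < x 1 < ⋯ < x n`: the zeros of the shifted Gegenbauer
polynomial of degree `n + 1`, listed in ascending order.  (There are exactly `n + 1` of them, so
the default value `0` is never used.) -/
def node (α l : ℝ) (n : ℕ) (i : Fin (n + 1)) : ℝ :=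
  ((shiftedGegenbauer α l (n + 1)).roots.toFinset.sort (· ≤ ·)).getD (i : ℕ) 0

/-- The Christoffel numbers, i.e. the weights of the Gauss quadrature at the nodes `x i` for the
weight function `(x (l - x)) ^ (α - 1/2)` on `[0, l]`: the weighted integrals of the fundamental
Lagrange polynomials of the nodes. -/
def christoffel (α l : ℝ) (n : ℕ) (i : Fin (n + 1)) : ℝ :=
  ∫ x in (0 : ℝ)..l, (x * (l - x)) ^ (α - 1 / 2) *
    (Lagrange.basis Finset.univ (node α l n) i).eval x

/-- The shifted barycentric weights. -/
def baryWeight (α l : ℝ) (n : ℕ) (i : Fin (n + 1)) : ℝ :=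
  2 * (-1) ^ (i : ℕ) *
    Real.sqrt ((4 : ℝ) ^ α * l ^ (-2 * (1 + α)) * (l - node α l n i) * node α l n i *
      christoffel α l n i)

open Classical in
/-- The fundamental Lagrange interpolating polynomials in barycentric form.  At the nodes, where
the barycentric quotient is not defined, the values are those of its continuous extension. -/
def baryLagrange (α l : ℝ) (n : ℕ) (j : Fin (n + 1)) (x : ℝ) : ℝ :=
  if x = node α l n j then 1
  else if ∃ k, x = node α l n k then 0
  else (baryWeight α l n j / (x - node α l n j)) /
    ∑ k, baryWeight α l n k / (x - node α l n k)

/-- The `q`-th order barycentric shifted Gegenbauer integration matrix.  For `q = 1` its entries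
are the integrals over `[0, x i]` of the barycentric Lagrange polynomials; for `q ≥ 1` its `i`-th
row is the Hadamard product of the `i`-th row of the first-order matrix with the row of the numbers
`(x i - x j) ^ (q - 1)`, divided by `(q - 1)!`. -/
def intMatrix (α l : ℝ) (n q : ℕ) : Matrix (Fin (n + 1)) (Fin (n + 1)) ℝ :=
  Matrix.of fun i j =>
    (node α l n i - node α l n j) ^ (q - 1) / (Nat.factorial (q - 1) : ℝ) *
      ∫ x in (0 : ℝ)..(node α l n i), baryLagrange α l n j x

/-- The `q`-fold iterated integral of `f` from `0` to `x`. -/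
def iterIntegral (f : ℝ → ℝ) : ℕ → ℝ → ℝ
  | 0, x => f x
  | q + 1, x => ∫ σ in (0 : ℝ)..x, iterIntegral f q σ

/-- The truncation error, at the node `x i`, of the `q`-th order barycentric shifted Gegenbauer
quadrature of `f`: the exact `q`-fold integral minus its approximation by the quadrature. -/
def truncError (α l : ℝ) (n q : ℕ) (f : ℝ → ℝ) (i : Fin (n + 1)) : ℝ :=
  iterIntegral f q (node α l n i) -
    (intMatrix α l n q).mulVec (fun j => f (node α l n j)) i

end BSGQ

end

/-!
By Cauchy's formula the `q`-fold integral of `f` is the integral over `[0, x i]` of `f y` against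
the kernel `(x i - y) ^ (q - 1) / (q - 1)!`, and the factor `(x i - x j) ^ (q - 1) / (q - 1)!` of
the integration matrix is the value of this kernel at the `j`-th node. The barycentric polynomials
are the Lagrange basis polynomials, because orthogonality and the Gegenbauer equation make the
Christoffel numbers proportional to `(x j * (l - x j) * p' (x j) ^ 2)⁻¹` for the nodal polynomial
`p`, so that `baryWeight` is proportional to the weights `(p' (x j))⁻¹`. The truncation error is
therefore the integral of an interpolation error, which is at most
`A / ((q - 1)! * (n + 1)!) * |p|`, and `p` is the shifted Gegenbauer polynomial divided by its
leading coefficient.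

On `[-1, 1]` the maximum of `|gegenbauer α (n + 1)|` is read off from Sonin's function
`G ^ 2 + (1 - t ^ 2) / λ * G' ^ 2`, which is monotone on each side of `0`: it gives the bound `1`
for `α ≥ 0` and a bound by the values at `0` for `α ≤ 0`. The asymptotic bounds follow from Euler's
limit for the Gamma function and Stirling's inequality.
-/

noncomputable section

namespace BSGQ

open MeasureTheory Polynomial Set

/-! ### Repeated integration -/

theorem iterIntegral_integral (f : ℝ → ℝ) (q : ℕ) :
    iterIntegral (fun y => ∫ t in (0 : ℝ)..y, f t) q = iterIntegral f (q + 1) := by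
  induction q with
  | zero => rfl
  | succ q ih =>
    funext x
    rw [iterIntegral, ih]
    rfl

theorem hasDerivAt_sub_pow_div_factorial (x y : ℝ) (q : ℕ) :
    HasDerivAt (fun y => (x - y) ^ (q + 1) / ((q + 1).factorial : ℝ))
      (-((x - y) ^ q / (q.factorial : ℝ))) y := by
  refine ((((hasDerivAt_id' y).const_sub x).pow (q + 1)).div_const _).congr_deriv ?_
  rw [Nat.factorial_succ, Nat.add_sub_cancel]
  push_cast
  field_simp

theorem iterIntegral_succ_eq {f : ℝ → ℝ} {x : ℝ} (hf : ContinuousOn f (uIcc 0 x)) (q : ℕ) :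
    iterIntegral f (q + 1) x = ∫ y in (0 : ℝ)..x, (x - y) ^ q / (q.factorial : ℝ) * f y := by
  induction q generalizing f with
  | zero => simp [iterIntegral]
  | succ q ih =>
    have hF : ContinuousOn (fun y => ∫ t in (0 : ℝ)..y, f t) (uIcc 0 x) :=
      intervalIntegral.continuousOn_primitive_interval'
        (hf.intervalIntegrable (a := 0) (b := x)) left_mem_uIcc
    have hF' : ∀ y ∈ Ioo (min 0 x) (max 0 x),
        HasDerivAt (fun y => ∫ t in (0 : ℝ)..y, f t) (f y) y := fun y hy =>
      have hy' : y ∈ uIcc 0 x := Ioo_subset_Icc_self hy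
      have hfy := hf.mono (uIcc_subset_uIcc left_mem_uIcc hy')
      intervalIntegral.integral_hasDerivAt_right hfy.intervalIntegrable
        ((hf.mono Ioo_subset_Icc_self).stronglyMeasurableAtFilter isOpen_Ioo y hy)
        (hf.continuousAt (Icc_mem_nhds hy.1 hy.2))
    have hu : Continuous fun y => (x - y) ^ (q + 1) / ((q + 1).factorial : ℝ) := by fun_prop
    have hu' : Continuous fun y => -((x - y) ^ q / (q.factorial : ℝ)) := by fun_prop
    rw [← iterIntegral_integral, ih hF,
      intervalIntegral.integral_mul_deriv_eq_deriv_mul_of_hasDerivAt hu.continuousOn hF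
        (fun y _ => hasDerivAt_sub_pow_div_factorial x y q) hF' (hu'.intervalIntegrable 0 x)
        hf.intervalIntegrable]
    simp

/-! ### The error of polynomial interpolation -/

theorem exists_derivWithin_Icc_eq_zero {a b u v : ℝ} {h : ℝ → ℝ} (hc : ContinuousOn h (Icc a b))
    (hu : u ∈ Icc a b) (hv : v ∈ Icc a b) (huv : u < v) (hu0 : h u = 0) (hv0 : h v = 0) :
    ∃ ξ ∈ Ioo u v, derivWithin h (Icc a b) ξ = 0 := by
  obtain ⟨ξ, hξ, hd⟩ := exists_deriv_eq_zero huv (hc.mono (Icc_subset_Icc hu.1 hv.2))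
    (hu0.trans hv0.symm)
  have hnhds : Icc a b ∈ nhds ξ := Icc_mem_nhds (hu.1.trans_lt hξ.1) (hξ.2.trans_le hv.2)
  exact ⟨ξ, hξ, by rw [derivWithin_of_mem_nhds hnhds, hd]⟩

theorem exists_iteratedDerivWithin_Icc_eq_zero {a b : ℝ} (k : ℕ) {h : ℝ → ℝ}
    (hh : ContDiffOn ℝ k h (Icc a b)) {z : Fin (k + 2) → ℝ} (hz : StrictMono z)
    (hzm : ∀ i, z i ∈ Icc a b) (hz0 : ∀ i, h (z i) = 0) :
    ∃ ξ ∈ Ioo a b, iteratedDerivWithin (k + 1) h (Icc a b) ξ = 0 := by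
  have hmem : ∀ {u v ξ : ℝ}, u ∈ Icc a b → v ∈ Icc a b → ξ ∈ Ioo u v → ξ ∈ Ioo a b :=
    fun hu hv hξ => ⟨hu.1.trans_lt hξ.1, hξ.2.trans_le hv.2⟩
  induction k generalizing h with
  | zero =>
    obtain ⟨ξ, hξ, hd⟩ := exists_derivWithin_Icc_eq_zero hh.continuousOn (hzm 0) (hzm 1)
      (hz Fin.zero_lt_one) (hz0 0) (hz0 1)
    exact ⟨ξ, hmem (hzm 0) (hzm 1) hξ, by rw [zero_add, iteratedDerivWithin_one, hd]⟩
  | succ k ih =>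
    have hab : a < b := (hzm 0).1.trans_lt ((hz (Fin.succ_pos 0)).trans_le (hzm _).2)
    choose ξ hξ hξ0 using fun i : Fin (k + 2) =>
      exists_derivWithin_Icc_eq_zero hh.continuousOn (hzm i.castSucc) (hzm i.succ)
        (hz i.castSucc_lt_succ) (hz0 _) (hz0 _)
    have hξ_mono : StrictMono ξ := fun i j hij =>
      (hξ i).2.trans_le ((hz.monotone (Fin.succ_le_castSucc_iff.2 hij)).trans (hξ j).1.le)
    rw [iteratedDerivWithin_succ']
    exact ih (hh.derivWithin (uniqueDiffOn_Icc hab) (by norm_cast)) hξ_mono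
      (fun i => Ioo_subset_Icc_self (hmem (hzm _) (hzm _) (hξ i))) hξ0

theorem exists_iteratedDerivWithin_Icc_eq_zero_of_finset {a b : ℝ} {k : ℕ} {h : ℝ → ℝ}
    (hh : ContDiffOn ℝ k h (Icc a b)) {Z : Finset ℝ} (hcard : Z.card = k + 2)
    (hZ : ∀ z ∈ Z, z ∈ Icc a b ∧ h z = 0) :
    ∃ ξ ∈ Ioo a b, iteratedDerivWithin (k + 1) h (Icc a b) ξ = 0 :=
  exists_iteratedDerivWithin_Icc_eq_zero k hh (Z.orderEmbOfFin hcard).strictMono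
    (fun i => (hZ _ (Z.orderEmbOfFin_mem hcard i)).1)
    (fun i => (hZ _ (Z.orderEmbOfFin_mem hcard i)).2)

theorem iteratedDeriv_polynomial_eval (p : ℝ[X]) (k : ℕ) :
    iteratedDeriv k (fun y => p.eval y) = fun y => (derivative^[k] p).eval y := by
  induction k generalizing p with
  | zero => simp
  | succ k ih =>
    rw [iteratedDeriv_succ', show deriv (fun y => p.eval y) = fun y => p.derivative.eval y from
      funext fun y => p.deriv, ih]
    rfl

theorem eval_iterate_derivative_of_natDegree_le {R : Type*} [Semiring R] {p : R[X]} {n : ℕ}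
    (hp : p.natDegree ≤ n) (x : R) :
    (derivative^[n] p).eval x = n.factorial * p.coeff n := by
  have h0 : (derivative^[n] p).natDegree ≤ 0 :=
    (p.natDegree_iterate_derivative n).trans (Nat.sub_eq_zero_of_le hp).le
  rw [eq_C_of_natDegree_le_zero h0, eval_C, coeff_iterate_derivative, zero_add,
    Nat.descFactorial_self, nsmul_eq_mul]

theorem contDiff_polynomial_eval (p : ℝ[X]) (n : WithTop ℕ∞) : ContDiff ℝ n fun x => p.eval x := by
  simpa only [coe_aeval_eq_eval] using p.contDiff_aeval (𝕜 := ℝ) n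

theorem iteratedDerivWithin_polynomial_eval_of_natDegree_le {p : ℝ[X]} {n : ℕ}
    (hp : p.natDegree ≤ n) {s : Set ℝ} (hs : UniqueDiffOn ℝ s) {x : ℝ} (hx : x ∈ s) :
    iteratedDerivWithin n (fun y => p.eval y) s x = n.factorial * p.coeff n := by
  rw [iteratedDerivWithin_eq_iteratedDeriv hs (contDiff_polynomial_eval p n).contDiffAt hx,
    iteratedDeriv_polynomial_eval]
  exact eval_iterate_derivative_of_natDegree_le hp x

section Interpolation

variable {ι : Type*} [DecidableEq ι] {s : Finset ι} {v : ι → ℝ} {n : ℕ}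

theorem natDegree_interpolate_add_C_mul_nodal_le (hv : InjOn v s) (hs : s.card = n + 1)
    (r : ι → ℝ) (c : ℝ) :
    (Lagrange.interpolate s v r + C c * Lagrange.nodal s v).natDegree ≤ n + 1 :=
  natDegree_add_le_of_degree_le
    (natDegree_le_of_degree_le (hs ▸ (Lagrange.degree_interpolate_lt r hv).le))
    ((natDegree_C_mul_le _ _).trans (by rw [Lagrange.natDegree_nodal, hs]))

theorem coeff_interpolate_add_C_mul_nodal (hv : InjOn v s) (hs : s.card = n + 1)
    (r : ι → ℝ) (c : ℝ) :
    (Lagrange.interpolate s v r + C c * Lagrange.nodal s v).coeff (n + 1) = c := by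
  have hL : (Lagrange.interpolate s v r).coeff s.card = 0 :=
    coeff_eq_zero_of_degree_lt (Lagrange.degree_interpolate_lt r hv)
  have hW : (Lagrange.nodal s v).coeff s.card = 1 := by
    rw [← Lagrange.natDegree_nodal (s := s) (v := v)]
    exact Lagrange.nodal_monic
  rw [← hs, coeff_add, coeff_C_mul, hL, hW, zero_add, mul_one]

theorem exists_sub_eval_interpolate_eq {a b : ℝ} (hab : a < b) {g : ℝ → ℝ}
    (hg : ContDiffOn ℝ ((n + 1 : ℕ) : WithTop ℕ∞) g (Icc a b)) (hv : InjOn v s)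
    (hs : s.card = n + 1) (hvm : ∀ i ∈ s, v i ∈ Icc a b) {y : ℝ} (hy : y ∈ Icc a b) :
    ∃ ξ ∈ Ioo a b, g y - (Lagrange.interpolate s v fun i => g (v i)).eval y =
      iteratedDerivWithin (n + 1) g (Icc a b) ξ / ((n + 1).factorial : ℝ) *
        (Lagrange.nodal s v).eval y := by
  set L := Lagrange.interpolate s v fun i => g (v i)
  have hLv : ∀ i ∈ s, L.eval (v i) = g (v i) :=
    fun i hi => Lagrange.eval_interpolate_at_node _ hv hi
  by_cases hyv : ∃ i ∈ s, y = v i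
  · obtain ⟨i, hi, rfl⟩ := hyv
    obtain ⟨ξ, hξ⟩ := nonempty_Ioo.2 hab
    exact ⟨ξ, hξ, by rw [hLv i hi, Lagrange.eval_nodal_at_node hi, sub_self, mul_zero]⟩
  push Not at hyv
  have hWy : (Lagrange.nodal s v).eval y ≠ 0 := Lagrange.eval_nodal_not_at_node hyv
  -- `c` is chosen so that `g - L - c W` vanishes at `y` in addition to the nodes.
  set c := (g y - L.eval y) / (Lagrange.nodal s v).eval y with hc
  set P := L + C c * Lagrange.nodal s v with hP
  have hPeval : ∀ x, P.eval x = L.eval x + c * (Lagrange.nodal s v).eval x := fun x => by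
    rw [hP, eval_add, eval_mul, eval_C]
  have hzero : ∀ z ∈ insert y (s.image v), z ∈ Icc a b ∧ g z - P.eval z = 0 := by
    simp only [Finset.forall_mem_insert, Finset.forall_mem_image, hPeval]
    refine ⟨⟨hy, ?_⟩, fun i hi => ⟨hvm i hi, ?_⟩⟩
    · rw [hc, div_mul_cancel₀ _ hWy, add_sub_cancel, sub_self]
    · rw [hLv i hi, Lagrange.eval_nodal_at_node hi, mul_zero, add_zero, sub_self]
  have hcard : (insert y (s.image v)).card = n + 2 := by
    rw [Finset.card_insert_of_notMem (by simpa using fun i hi => (hyv i hi).symm),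
      Finset.card_image_of_injOn hv, hs]
  have hPc := (contDiff_polynomial_eval P ((n + 1 : ℕ) : WithTop ℕ∞)).contDiffOn (s := Icc a b)
  obtain ⟨ξ, hξ, hξ0⟩ := exists_iteratedDerivWithin_Icc_eq_zero_of_finset
    ((hg.sub hPc).of_le (by norm_cast; omega)) hcard hzero
  have hξm := Ioo_subset_Icc_self hξ
  have hgξ := hξ0.symm.trans
    (iteratedDerivWithin_sub hξm (uniqueDiffOn_Icc hab) (hg ξ hξm) (hPc ξ hξm))
  rw [iteratedDerivWithin_polynomial_eval_of_natDegree_le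
      (natDegree_interpolate_add_C_mul_nodal_le hv hs _ c) (uniqueDiffOn_Icc hab) hξm,
    coeff_interpolate_add_C_mul_nodal hv hs, eq_comm, sub_eq_zero] at hgξ
  exact ⟨ξ, hξ, by
    rw [hgξ, mul_div_cancel_left₀ _ (by positivity), hc, div_mul_cancel₀ _ hWy]⟩

theorem abs_sub_eval_interpolate_le {a b A : ℝ} (hab : a < b) {g : ℝ → ℝ}
    (hg : ContDiffOn ℝ ((n + 1 : ℕ) : WithTop ℕ∞) g (Icc a b)) (hv : InjOn v s)
    (hs : s.card = n + 1) (hvm : ∀ i ∈ s, v i ∈ Icc a b)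
    (hA : ∀ x ∈ Ioo a b, |iteratedDerivWithin (n + 1) g (Icc a b) x| ≤ A)
    {y : ℝ} (hy : y ∈ Icc a b) :
    |g y - (Lagrange.interpolate s v fun i => g (v i)).eval y| ≤
      A / ((n + 1).factorial : ℝ) * |(Lagrange.nodal s v).eval y| := by
  obtain ⟨ξ, hξ, h⟩ := exists_sub_eval_interpolate_eq hab hg hv hs hvm hy
  rw [h, abs_mul, abs_div, Nat.abs_cast]
  gcongr
  exact hA ξ hξ

end Interpolation

/-! ### Orthogonal polynomials for a positive functional -/

/-- A linear functional on real polynomials is positive on `S` if it is strictly positive at every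
nonzero polynomial that is nonnegative on `S`. -/
def IsPositiveOn (φ : ℝ[X] →ₗ[ℝ] ℝ) (S : Set ℝ) : Prop :=
  ∀ p : ℝ[X], p ≠ 0 → (∀ x ∈ S, 0 ≤ p.eval x) → 0 < φ p

/-- A polynomial is orthogonal for the functional `φ` if it is `φ`-orthogonal to every polynomial of
smaller degree. -/
def IsOrthogonal (φ : ℝ[X] →ₗ[ℝ] ℝ) (p : ℝ[X]) : Prop :=
  ∀ q : ℝ[X], q.degree < p.degree → φ (p * q) = 0

/-- The Pearson equation `(σ w)' = τ w` for the weight of a functional, in the integrated form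
`∫ w (σ p' + τ p) = 0`. -/
def SatisfiesPearson (φ : ℝ[X] →ₗ[ℝ] ℝ) (σ τ : ℝ[X]) : Prop :=
  ∀ p : ℝ[X], φ (σ * derivative p + τ * p) = 0

section Functional

variable {φ : ℝ[X] →ₗ[ℝ] ℝ} {S : Set ℝ} {p q r t σ τ : ℝ[X]}

theorem IsPositiveOn.map_mul_self_pos (hφ : IsPositiveOn φ S) (hp : p ≠ 0) : 0 < φ (p * p) :=
  hφ _ (mul_ne_zero hp hp) fun x _ => by rw [eval_mul]; exact mul_self_nonneg _

theorem IsOrthogonal.squarefree (h : IsOrthogonal φ p) (hφ : IsPositiveOn φ S) (hp : p ≠ 0) :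
    Squarefree p := by
  rintro u ⟨s, rfl⟩
  have hu : u ≠ 0 := by rintro rfl; simp at hp
  have hs : s ≠ 0 := by rintro rfl; simp at hp
  by_contra hunit
  have hdeg : s.degree < (u * u * s).degree := by
    have := natDegree_pos_iff_degree_pos.2 (degree_pos_of_ne_zero_of_nonunit hu hunit)
    refine degree_lt_degree ?_
    rw [natDegree_mul (mul_ne_zero hu hu) hs, natDegree_mul hu hu]
    omega
  have hpos := hφ.map_mul_self_pos (mul_ne_zero hu hs)
  rw [show u * s * (u * s) = u * u * s * s by ring, h s hdeg] at hpos
  exact hpos.false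

theorem forall_eval_pos_or_forall_eval_neg (hS : S.OrdConnected) (ht : ∀ x ∈ S, t.eval x ≠ 0) :
    (∀ x ∈ S, 0 < t.eval x) ∨ ∀ x ∈ S, t.eval x < 0 := by
  by_contra! h
  obtain ⟨⟨x, hx, hx0⟩, y, hy, hy0⟩ := h
  obtain ⟨z, hz, hz0⟩ :=
    hS.isPreconnected.intermediate_value hx hy t.continuous.continuousOn ⟨hx0, hy0⟩
  exact ht z hz hz0

theorem IsOrthogonal.natDegree_le_of_eq_mul (h : IsOrthogonal φ p) (hφ : IsPositiveOn φ S)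
    (hS : S.OrdConnected) (hp : p ≠ 0) (hprt : p = r * t) (ht : ∀ x ∈ S, t.eval x ≠ 0) :
    p.natDegree ≤ r.natDegree := by
  by_contra! hdeg
  have hpr : φ (r * r * t) = 0 := by
    rw [show r * r * t = p * r by rw [hprt]; ring]
    exact h r (degree_lt_degree hdeg)
  have hne : r * r * t ≠ 0 := by
    have hr : r ≠ 0 := by rintro rfl; simp [hp] at hprt
    rw [mul_assoc, ← hprt]
    exact mul_ne_zero hr hp
  rcases forall_eval_pos_or_forall_eval_neg hS ht with hpos | hneg
  · refine (hφ _ hne fun x hx => ?_).ne' hpr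
    rw [eval_mul, eval_mul]
    exact mul_nonneg (mul_self_nonneg _) (hpos x hx).le
  · refine (hφ _ (neg_ne_zero.2 hne) fun x hx => ?_).ne' (by rw [map_neg, hpr, neg_zero])
    rw [eval_neg, eval_mul, eval_mul, neg_nonneg]
    exact mul_nonpos_of_nonneg_of_nonpos (mul_self_nonneg _) (hneg x hx).le

theorem IsOrthogonal.natDegree_le_card_roots [DecidablePred (· ∈ S)] (h : IsOrthogonal φ p)
    (hφ : IsPositiveOn φ S) (hS : S.OrdConnected) (hp : p ≠ 0) :
    p.natDegree ≤ (p.roots.toFinset.filter (· ∈ S)).card := by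
  set Z := p.roots.toFinset.filter (· ∈ S)
  have hZ : Z.val ≤ p.roots := by
    rw [Multiset.le_iff_subset Z.nodup]
    exact fun x hx => Multiset.mem_toFinset.1 (Finset.mem_filter.1 hx).1
  obtain ⟨t, ht⟩ : Lagrange.nodal Z id ∣ p := (Multiset.prod_X_sub_C_dvd_iff_le_roots hp _).2 hZ
  refine (h.natDegree_le_of_eq_mul hφ hS hp ht fun x hx hx0 => ?_).trans
    Lagrange.natDegree_nodal.le
  have hroot : p.IsRoot x := by rw [IsRoot, ht, eval_mul, hx0, mul_zero]
  have hxZ : x ∈ Z := by simp [Z, hp, hroot.eq_zero, hx]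
  refine not_isUnit_X_sub_C x (h.squarefree hφ hp _ ?_)
  rw [ht]
  exact mul_dvd_mul (Lagrange.X_sub_C_dvd_nodal id hxZ) (dvd_iff_isRoot.2 hx0)

theorem IsOrthogonal.card_toFinset_roots (h : IsOrthogonal φ p) (hφ : IsPositiveOn φ S)
    (hS : S.OrdConnected) (hp : p ≠ 0) : p.roots.toFinset.card = p.natDegree := by
  classical
  exact ((Multiset.toFinset_card_le _).trans p.card_roots').antisymm
    ((h.natDegree_le_card_roots hφ hS hp).trans (Finset.card_filter_le _ _))

theorem IsOrthogonal.mem_of_isRoot (h : IsOrthogonal φ p) (hφ : IsPositiveOn φ S)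
    (hS : S.OrdConnected) (hp : p ≠ 0) {x : ℝ} (hx : p.IsRoot x) : x ∈ S := by
  classical
  have hfilter : p.roots.toFinset.filter (· ∈ S) = p.roots.toFinset :=
    Finset.eq_of_subset_of_card_le (Finset.filter_subset _ _)
      ((h.card_toFinset_roots hφ hS hp).trans_le (h.natDegree_le_card_roots hφ hS hp))
  exact Finset.filter_eq_self.1 hfilter x (by simp [hp, hx.eq_zero])

theorem IsOrthogonal.leadingCoeff_mul_map_mul (h : IsOrthogonal φ p) (hp : p ≠ 0) (hq : q.Monic)
    (hpq : q.degree = p.degree) : p.leadingCoeff * φ (p * q) = φ (p * p) := by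
  have hlc : p.leadingCoeff ≠ 0 := leadingCoeff_ne_zero.2 hp
  have hdeg : (C p.leadingCoeff * q).degree = p.degree := by rw [degree_C_mul hlc, hpq]
  have hsub := h _ (hdeg ▸ degree_sub_lt_left hdeg (by simp [hlc, hq.ne_zero]) (by simp [hq]))
  rw [mul_sub, map_sub, mul_left_comm, ← smul_eq_C_mul, map_smul, smul_eq_mul] at hsub
  exact sub_eq_zero.1 hsub

theorem IsOrthogonal.map_nodal_erase_mul {ι : Type*} [DecidableEq ι] {s : Finset ι} {v : ι → ℝ}
    (h : IsOrthogonal φ (Lagrange.nodal s v)) {j : ι} (hj : j ∈ s) (hq : q.natDegree ≤ s.card) :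
    φ (Lagrange.nodal (s.erase j) v * q) = q.eval (v j) * φ (Lagrange.nodal (s.erase j) v) := by
  obtain ⟨u, hu⟩ := X_sub_C_dvd_sub_C_eval (a := v j) (p := q)
  have hdeg : u.degree < (Lagrange.nodal s v).degree := by
    rw [Lagrange.degree_nodal]
    rcases eq_or_ne u 0 with rfl | hu0
    · simp
    refine degree_le_natDegree.trans_lt (Nat.cast_lt.2 ?_)
    have hnat := congrArg natDegree hu
    rw [natDegree_sub_C, natDegree_mul (X_sub_C_ne_zero _) hu0, natDegree_X_sub_C] at hnat
    omega
  have hsplit : Lagrange.nodal (s.erase j) v * q =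
      q.eval (v j) • Lagrange.nodal (s.erase j) v + Lagrange.nodal s v * u := by
    rw [Lagrange.nodal_eq_mul_nodal_erase hj, smul_eq_C_mul, ← sub_eq_iff_eq_add']
    linear_combination Lagrange.nodal (s.erase j) v * hu
  rw [hsplit, map_add, h u hdeg, add_zero, map_smul, smul_eq_mul]

theorem SatisfiesPearson.map_mul_of_ode (h : SatisfiesPearson φ σ τ) {c : ℝ}
    (hp : σ * derivative (derivative p) + τ * derivative p + C c * p = 0) :
    c * φ (p * q) = φ (σ * derivative p * derivative q) := by
  have hpq := h (derivative p * q)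
  rw [derivative_mul, show σ * (derivative (derivative p) * q + derivative p * derivative q) +
      τ * (derivative p * q) = σ * derivative p * derivative q - c • (p * q) by
    rw [smul_eq_C_mul]; linear_combination q * hp, map_sub, map_smul, smul_eq_mul] at hpq
  exact (sub_eq_zero.1 hpq).symm

theorem SatisfiesPearson.map_mul_eq_zero (h : SatisfiesPearson φ σ τ) {c d : ℝ} (hcd : c ≠ d)
    (hp : σ * derivative (derivative p) + τ * derivative p + C c * p = 0)
    (hq : σ * derivative (derivative q) + τ * derivative q + C d * q = 0) : φ (p * q) = 0 := by
  have hpq := h.map_mul_of_ode (q := q) hp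
  have hqp := h.map_mul_of_ode (q := p) hq
  rw [mul_right_comm, ← hpq, mul_comm q p] at hqp
  exact (mul_eq_zero.1 (by linear_combination hqp : (d - c) * φ (p * q) = 0)).resolve_left
    (sub_ne_zero.2 hcd.symm)

theorem isOrthogonal_of_pairwise (P : Sequence ℝ)
    (h : Pairwise fun m n => φ (P m * P n) = 0) (n : ℕ) : IsOrthogonal φ (P n) := by
  intro q hq
  rw [P.degree_eq, ← mem_degreeLT,
    ← P.span_degreeLT fun i _ => (leadingCoeff_ne_zero.2 (P.ne_zero i)).isUnit] at hq
  induction hq using Submodule.span_induction with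
  | mem x hx =>
    obtain ⟨m, hm, rfl⟩ := hx
    exact h (ne_of_gt hm)
  | zero => simp
  | add x y _ _ hx hy => rw [mul_add, map_add, hx, hy, add_zero]
  | smul c x _ hx => rw [mul_smul_comm, map_smul, hx, smul_zero]

end Functional

/-- Integration of polynomials over `[a, b]` against an integrable weight `w`, as a linear
functional. -/
def weightFunctional {w : ℝ → ℝ} {a b : ℝ} (hw : IntervalIntegrable w volume a b) :
    ℝ[X] →ₗ[ℝ] ℝ where
  toFun p := ∫ x in a..b, w x * p.eval x
  map_add' p q := by
    simp only [eval_add, mul_add]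
    exact intervalIntegral.integral_add (hw.mul_continuousOn p.continuousOn)
      (hw.mul_continuousOn q.continuousOn)
  map_smul' c p := by
    simp only [eval_smul, smul_eq_mul, RingHom.id_apply, mul_left_comm _ c]
    exact intervalIntegral.integral_const_mul _ _

theorem weightFunctional_apply {w : ℝ → ℝ} {a b : ℝ} (hw : IntervalIntegrable w volume a b)
    (p : ℝ[X]) : weightFunctional hw p = ∫ x in a..b, w x * p.eval x :=
  rfl

theorem isPositiveOn_weightFunctional {w : ℝ → ℝ} {a b : ℝ} (hab : a < b)
    (hw : IntervalIntegrable w volume a b) (hpos : ∀ x ∈ Ioo a b, 0 < w x) :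
    IsPositiveOn (weightFunctional hw) (Ioo a b) := by
  intro p hp h0
  rw [weightFunctional_apply, intervalIntegral.integral_of_le hab.le, integral_Ioc_eq_integral_Ioo]
  have hint : IntegrableOn (fun x => w x * p.eval x) (Ioo a b) :=
    (intervalIntegrable_iff_integrableOn_Ioo_of_le hab.le).1 (hw.mul_continuousOn p.continuousOn)
  have hnonneg : 0 ≤ᵐ[volume.restrict (Ioo a b)] fun x => w x * p.eval x := by
    filter_upwards [ae_restrict_mem measurableSet_Ioo] with x hx
    exact mul_nonneg (hpos x hx).le (h0 x hx)
  have hsupport : Ioo a b \ (p.roots.toFinset : Set ℝ) ⊆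
      Function.support (fun x => w x * p.eval x) ∩ Ioo a b := by
    rintro x ⟨hx, hxr⟩
    exact ⟨mul_ne_zero (hpos x hx).ne' (by simpa [hp] using hxr), hx⟩
  rw [setIntegral_pos_iff_support_of_nonneg_ae hnonneg hint]
  refine lt_of_lt_of_le ?_ (measure_mono hsupport)
  rw [measure_sdiff_null (Finset.measure_zero _ _), Real.volume_Ioo]
  simpa using hab

/-! ### Gegenbauer polynomials -/

section Gegenbauer

variable {α : ℝ}

theorem natCast_add_one_add_two_mul_pos (hα : -(1 / 2) < α) (m : ℕ) : 0 < (m : ℝ) + 1 + 2 * α := by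
  have : (0 : ℝ) ≤ m := m.cast_nonneg
  linarith

theorem gegenbauer_recurrence (hα : -(1 / 2) < α) (m : ℕ) :
    C ((m : ℝ) + 1 + 2 * α) * gegenbauer α (m + 2) =
      C (2 * ((m : ℝ) + 1 + α)) * X * gegenbauer α (m + 1) - C ((m : ℝ) + 1) * gegenbauer α m := by
  rw [gegenbauer, ← mul_assoc, ← C_mul,
    mul_inv_cancel₀ (natCast_add_one_add_two_mul_pos hα m).ne', C_1, one_mul]

theorem gegenbauer_structure_relations (hα : -(1 / 2) < α) (m : ℕ) :
    (1 - X ^ 2) * derivative (gegenbauer α (m + 1)) =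
        C ((m : ℝ) + 1) * (gegenbauer α m - X * gegenbauer α (m + 1)) ∧
      (1 - X ^ 2) * derivative (gegenbauer α m) =
        C ((m : ℝ) + 2 * α) * (X * gegenbauer α m - gegenbauer α (m + 1)) := by
  induction m with
  | zero =>
    simp only [gegenbauer, derivative_X, derivative_one, Nat.cast_zero, zero_add, C_1]
    constructor <;> ring
  | succ m ih =>
    obtain ⟨h1, h2⟩ := ih
    have hr := gegenbauer_recurrence hα m
    have hd := congrArg derivative hr
    simp only [derivative_mul, derivative_sub, derivative_C, derivative_X] at hd
    have hne : C ((m : ℝ) + 1 + 2 * α) ≠ 0 :=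
      C_ne_zero.2 (natCast_add_one_add_two_mul_pos hα m).ne'
    simp only [C_add, C_mul, C_1, C_ofNat, Nat.cast_add, Nat.cast_one] at *
    constructor
    · apply mul_left_cancel₀ hne
      linear_combination (1 - X ^ 2) * hd + 2 * (C (m : ℝ) + 1 + C α) * X * h1 -
        (C (m : ℝ) + 1) * h2 + (C (m : ℝ) + 2) * X * hr
    · linear_combination h1 + hr

theorem gegenbauer_ode (hα : -(1 / 2) < α) (m : ℕ) :
    (1 - X ^ 2) * derivative (derivative (gegenbauer α m)) -
      C (2 * α + 1) * X * derivative (gegenbauer α m) +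
      C ((m : ℝ) * (m + 2 * α)) * gegenbauer α m = 0 := by
  cases m with
  | zero => simp [gegenbauer]
  | succ m =>
    obtain ⟨h1, h2⟩ := gegenbauer_structure_relations hα m
    obtain ⟨-, h3⟩ := gegenbauer_structure_relations hα (m + 1)
    have hd := congrArg derivative h1
    simp only [derivative_mul, derivative_sub, derivative_C, derivative_X, derivative_one,
      derivative_X_pow, Nat.cast_ofNat] at hd
    have hne : (1 - X ^ 2 : ℝ[X]) ≠ 0 := by
      rw [sub_ne_zero, ne_comm]
      exact fun h => by simpa using congrArg (eval 0) h
    apply mul_left_cancel₀ hne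
    simp only [C_add, C_mul, C_1, C_ofNat, Nat.cast_add, Nat.cast_one] at *
    linear_combination (1 - X ^ 2) * hd + (C (m : ℝ) + 1) * h2 -
      ((C (m : ℝ) + 2 * C α) * X) * h1

theorem gegenbauer_eval_one (hα : -(1 / 2) < α) (m : ℕ) : (gegenbauer α m).eval 1 = 1 := by
  induction m with
  | zero => simp [gegenbauer]
  | succ m ih =>
    have h := congrArg (eval 1) (gegenbauer_structure_relations hα m).1
    have hm : (m : ℝ) + 1 ≠ 0 := by positivity
    simp only [eval_mul, eval_sub, eval_pow, eval_X, eval_one, eval_C, ih, one_pow, sub_self,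
      zero_mul, one_mul, zero_eq_mul, hm, false_or] at h
    exact (sub_eq_zero.1 h).symm

theorem gegenbauer_comp_neg_X (α : ℝ) (m : ℕ) :
    (gegenbauer α m).comp (-X) = C ((-1) ^ m) * gegenbauer α m := by
  induction m using Nat.twoStepInduction with
  | zero => simp [gegenbauer]
  | one => simp [gegenbauer]
  | more m ih1 ih2 =>
    simp only [gegenbauer, mul_comp, sub_comp, C_comp, X_comp, ih1, ih2, pow_succ, C_mul, C_neg,
      C_1]
    ring

theorem gegenbauer_eval_neg (α : ℝ) (m : ℕ) (x : ℝ) :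
    (gegenbauer α m).eval (-x) = (-1) ^ m * (gegenbauer α m).eval x := by
  simpa [eval_comp] using congrArg (eval x) (gegenbauer_comp_neg_X α m)

theorem derivative_gegenbauer_eval_neg (α : ℝ) (m : ℕ) (x : ℝ) :
    (derivative (gegenbauer α m)).eval (-x) =
      -((-1) ^ m * (derivative (gegenbauer α m)).eval x) := by
  have h := congrArg (fun p => (derivative p).eval x) (gegenbauer_comp_neg_X α m)
  simp only [derivative_comp, derivative_neg, derivative_X, derivative_C_mul, eval_mul, eval_neg,
    eval_one, eval_comp, eval_X, eval_C] at h
  linarith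

theorem gegenbauer_eval_zero_succ_succ (hα : -(1 / 2) < α) (m : ℕ) :
    (gegenbauer α (m + 2)).eval 0 =
      -(((m : ℝ) + 1) / ((m : ℝ) + 1 + 2 * α)) * (gegenbauer α m).eval 0 := by
  have h := congrArg (eval 0) (gegenbauer_recurrence hα m)
  simp only [eval_mul, eval_sub, eval_X, eval_C] at h
  have := (natCast_add_one_add_two_mul_pos hα m).ne'
  field_simp
  linarith

theorem gegenbauer_eval_zero_of_odd (α : ℝ) {m : ℕ} (hm : Odd m) :
    (gegenbauer α m).eval 0 = 0 := by
  have h := gegenbauer_eval_neg α m 0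
  rw [neg_zero, hm.neg_one_pow] at h
  linarith

theorem abs_gegenbauer_eval_zero (hα : -(1 / 2) < α) (k : ℕ) :
    |(gegenbauer α (2 * k)).eval 0| =
      (ascPochhammer ℝ k).eval (1 / 2) / (ascPochhammer ℝ k).eval (α + 1 / 2) := by
  induction k with
  | zero => simp [gegenbauer]
  | succ k ih =>
    have hk : 0 < 2 * (k : ℝ) + 1 + 2 * α := by
      exact_mod_cast natCast_add_one_add_two_mul_pos hα (2 * k)
    rw [show 2 * (k + 1) = 2 * k + 2 by ring, gegenbauer_eval_zero_succ_succ hα, abs_mul, ih,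
      abs_neg, ascPochhammer_succ_eval, ascPochhammer_succ_eval]
    have := ascPochhammer_pos k (α + 1 / 2) (by linarith)
    have hk' : 0 < α + 1 / 2 + k := by linarith
    push_cast
    rw [abs_of_pos (by positivity), div_mul_div_comm,
      div_eq_div_iff (by positivity) (by positivity)]
    ring

theorem derivative_gegenbauer_eval_zero (hα : -(1 / 2) < α) (m : ℕ) :
    (derivative (gegenbauer α (m + 1))).eval 0 = ((m : ℝ) + 1) * (gegenbauer α m).eval 0 := by
  simpa using congrArg (eval 0) (gegenbauer_structure_relations hα m).1

theorem natDegree_gegenbauer_le (α : ℝ) (m : ℕ) : (gegenbauer α m).natDegree ≤ m := by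
  induction m using Nat.twoStepInduction with
  | zero => simp [gegenbauer]
  | one => simp [gegenbauer]
  | more m ih1 ih2 =>
    rw [gegenbauer, mul_assoc (C _) X]
    refine (natDegree_C_mul_le _ _).trans ((natDegree_sub_le _ _).trans (max_le ?_ ?_))
    · refine (natDegree_C_mul_le _ _).trans (natDegree_mul_le.trans ?_)
      rw [natDegree_X]
      omega
    · exact (natDegree_C_mul_le _ _).trans (by omega)

theorem coeff_gegenbauer (α : ℝ) (m : ℕ) :
    (gegenbauer α (m + 1)).coeff (m + 1) =
      2 ^ m * (ascPochhammer ℝ m).eval (α + 1) / (ascPochhammer ℝ m).eval (2 * α + 1) := by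
  induction m with
  | zero => simp [gegenbauer]
  | succ m ih =>
    rw [gegenbauer, coeff_C_mul, coeff_sub, mul_assoc, coeff_C_mul, coeff_X_mul, ih, coeff_C_mul,
      coeff_eq_zero_of_natDegree_lt ((natDegree_gegenbauer_le α m).trans_lt (by omega)),
      ascPochhammer_succ_eval, ascPochhammer_succ_eval,
      show (m : ℝ) + 1 + 2 * α = 2 * α + 1 + m by ring,
      div_eq_mul_inv, div_eq_mul_inv, mul_inv]
    ring

theorem coeff_gegenbauer_pos (hα : -(1 / 2) < α) (m : ℕ) :
    0 < (gegenbauer α (m + 1)).coeff (m + 1) := by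
  have := ascPochhammer_pos m (α + 1) (by linarith)
  have := ascPochhammer_pos m (2 * α + 1) (by linarith)
  rw [coeff_gegenbauer]
  positivity

theorem natDegree_gegenbauer (hα : -(1 / 2) < α) (m : ℕ) : (gegenbauer α m).natDegree = m := by
  cases m with
  | zero => simp [gegenbauer]
  | succ m =>
    exact natDegree_eq_of_le_of_coeff_ne_zero (natDegree_gegenbauer_le α _)
      (coeff_gegenbauer_pos hα m).ne'

theorem leadingCoeff_gegenbauer_succ (hα : -(1 / 2) < α) (m : ℕ) :
    (gegenbauer α (m + 1)).leadingCoeff =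
      2 ^ m * (ascPochhammer ℝ m).eval (α + 1) / (ascPochhammer ℝ m).eval (2 * α + 1) := by
  rw [leadingCoeff, natDegree_gegenbauer hα, coeff_gegenbauer]

theorem leadingCoeff_gegenbauer_pos (hα : -(1 / 2) < α) (m : ℕ) :
    0 < (gegenbauer α m).leadingCoeff := by
  cases m with
  | zero => simp [gegenbauer]
  | succ m => simpa [leadingCoeff, natDegree_gegenbauer hα] using coeff_gegenbauer_pos hα m

/-! ### Sonin's function -/

/-- Sonin's function `G² + (1 - x²) G'² / (m (m + 2 α))` of the Gegenbauer polynomial `G` of degree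
`m ≠ 0`. It dominates `G²` on `[-1, 1]`, and by the differential equation it is monotone on either
side of `0`. -/
def sonin (α : ℝ) (m : ℕ) (x : ℝ) : ℝ :=
  (gegenbauer α m).eval x ^ 2 +
    (1 - x ^ 2) * (derivative (gegenbauer α m)).eval x ^ 2 / ((m : ℝ) * (m + 2 * α))

theorem eigenvalue_pos (hα : -(1 / 2) < α) {m : ℕ} (hm : m ≠ 0) : 0 < (m : ℝ) * (m + 2 * α) := by
  have : (1 : ℝ) ≤ m := by exact_mod_cast Nat.one_le_iff_ne_zero.2 hm
  exact mul_pos (by linarith) (by linarith)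

theorem hasDerivAt_sonin (hα : -(1 / 2) < α) {m : ℕ} (hm : m ≠ 0) (x : ℝ) :
    HasDerivAt (sonin α m)
      (4 * α * x * (derivative (gegenbauer α m)).eval x ^ 2 / ((m : ℝ) * (m + 2 * α))) x := by
  have hlam := eigenvalue_pos hα hm
  have hG := (gegenbauer α m).hasDerivAt x
  have hG' := (derivative (gegenbauer α m)).hasDerivAt x
  have hode := congrArg (eval x) (gegenbauer_ode hα m)
  simp only [eval_mul, eval_sub, eval_X, eval_C, eval_one, eval_add, eval_pow, eval_zero] at hode
  refine ((hG.pow 2).add (((((hasDerivAt_id' x).pow 2).const_sub 1).mul (hG'.pow 2)).div_const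
    ((m : ℝ) * (m + 2 * α)))).congr_deriv ?_
  rw [eq_div_iff hlam.ne', add_mul, div_mul_cancel₀ _ hlam.ne']
  simp only [Pi.pow_apply]
  push_cast
  linear_combination 2 * (derivative (gegenbauer α m)).eval x * hode

theorem continuous_sonin (α : ℝ) (m : ℕ) : Continuous (sonin α m) := by
  unfold sonin
  fun_prop

theorem monotoneOn_const_mul_sonin (hα : -(1 / 2) < α) {m : ℕ} (hm : m ≠ 0) {c : ℝ}
    (hc : 0 ≤ c * α) : MonotoneOn (fun x => c * sonin α m x) (Ici 0) := by
  refine monotoneOn_of_hasDerivWithinAt_nonneg (convex_Ici 0)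
    ((continuous_sonin α m).const_mul c).continuousOn
    (fun x _ => ((hasDerivAt_sonin hα hm x).const_mul c).hasDerivWithinAt) fun x hx => ?_
  rw [interior_Ici] at hx
  have hlam := eigenvalue_pos hα hm
  rw [← mul_div_assoc, ← mul_assoc, ← mul_assoc, mul_left_comm]
  exact div_nonneg (mul_nonneg (mul_nonneg (mul_nonneg zero_le_four hc) (mem_Ioi.1 hx).le)
    (sq_nonneg _)) hlam.le

theorem sonin_abs (α : ℝ) (m : ℕ) (x : ℝ) : sonin α m |x| = sonin α m x := by
  rcases abs_choice x with h | h
  · rw [h]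
  · rw [h, sonin, sonin, gegenbauer_eval_neg, derivative_gegenbauer_eval_neg, neg_sq, neg_sq,
      mul_pow, mul_pow, ← pow_mul, (even_two.mul_left m).neg_one_pow, one_mul, one_mul]

theorem sq_gegenbauer_le_sonin (hα : -(1 / 2) < α) {m : ℕ} (hm : m ≠ 0) {x : ℝ}
    (hx : |x| ≤ 1) : (gegenbauer α m).eval x ^ 2 ≤ sonin α m x := by
  have : 0 ≤ 1 - x ^ 2 := sub_nonneg.2 ((sq_le_one_iff_abs_le_one x).2 hx)
  have := eigenvalue_pos hα hm
  exact le_add_of_nonneg_right (by positivity)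

theorem sonin_le_sonin_zero (hα : -(1 / 2) < α) (hα0 : α ≤ 0) {m : ℕ} (hm : m ≠ 0) (x : ℝ) :
    sonin α m x ≤ sonin α m 0 := by
  have h := monotoneOn_const_mul_sonin hα hm (c := -1) (by linarith) self_mem_Ici
    (mem_Ici.2 (abs_nonneg x)) (abs_nonneg x)
  rw [← sonin_abs α m x]
  linarith

theorem abs_gegenbauer_le_one (hα : 0 ≤ α) (m : ℕ) {x : ℝ} (hx : |x| ≤ 1) :
    |(gegenbauer α m).eval x| ≤ 1 := by
  rcases eq_or_ne m 0 with rfl | hm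
  · simp [gegenbauer]
  have hα' : -(1 / 2) < α := by linarith
  have hmono := monotoneOn_const_mul_sonin hα' hm (c := 1) (by linarith)
    (mem_Ici.2 (abs_nonneg x)) (mem_Ici.2 zero_le_one) hx
  simp only [one_mul, sonin_abs] at hmono
  refine (sq_le_one_iff_abs_le_one _).1
    (((sq_gegenbauer_le_sonin hα' hm hx).trans hmono).trans_eq ?_)
  simp [sonin, gegenbauer_eval_one hα']

theorem abs_gegenbauer_le_of_even (hα : -(1 / 2) < α) (hα0 : α ≤ 0) {m : ℕ} (hm : Even m) {x : ℝ}
    (hx : |x| ≤ 1) : |(gegenbauer α m).eval x| ≤ |(gegenbauer α m).eval 0| := by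
  rcases m with - | m
  · simp [gegenbauer]
  refine sq_le_sq.1 (((sq_gegenbauer_le_sonin hα m.succ_ne_zero hx).trans
    (sonin_le_sonin_zero hα hα0 m.succ_ne_zero x)).trans_eq ?_)
  have hodd : Odd m := by simpa [Nat.even_add_one] using hm
  simp [sonin, derivative_gegenbauer_eval_zero hα, gegenbauer_eval_zero_of_odd α hodd]

theorem abs_gegenbauer_succ_le_of_even (hα : -(1 / 2) < α) (hα0 : α ≤ 0) {m : ℕ} (hm : Even m)
    {x : ℝ} (hx : |x| ≤ 1) :
    |(gegenbauer α (m + 1)).eval x| ≤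
      ((m : ℝ) + 1) * |(gegenbauer α m).eval 0| / √(((m : ℝ) + 1) * (m + 1 + 2 * α)) := by
  have hlam := eigenvalue_pos hα m.succ_ne_zero
  push_cast at hlam
  refine abs_le_of_sq_le_sq (((sq_gegenbauer_le_sonin hα m.succ_ne_zero hx).trans
    (sonin_le_sonin_zero hα hα0 m.succ_ne_zero x)).trans_eq ?_) (by positivity)
  rw [sonin, Nat.succ_eq_add_one, derivative_gegenbauer_eval_zero hα,
    gegenbauer_eval_zero_of_odd α hm.add_one, div_pow, Real.sq_sqrt hlam.le, mul_pow, mul_pow,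
    sq_abs]
  push_cast
  ring

end Gegenbauer

/-! ### Shifted Gegenbauer polynomials -/

theorem satisfiesPearson_weightFunctional {w W : ℝ → ℝ} {a b : ℝ} {σ τ : ℝ[X]} (hab : a ≤ b)
    (hw : IntervalIntegrable w volume a b) (hW : ContinuousOn W (Icc a b)) (ha : W a = 0)
    (hb : W b = 0) (hσ : ∀ x ∈ Ioo a b, W x = σ.eval x * w x)
    (hτ : ∀ x ∈ Ioo a b, HasDerivAt W (τ.eval x * w x) x) :
    SatisfiesPearson (weightFunctional hw) σ τ := by
  intro p
  have h := intervalIntegral.integral_eq_sub_of_hasDerivAt_of_le hab (hW.mul p.continuousOn)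
    (f' := fun x => w x * (σ * derivative p + τ * p).eval x)
    (fun x hx => ((hτ x hx).mul (p.hasDerivAt x)).congr_deriv ?_)
    (hw.mul_continuousOn (Polynomial.continuousOn _))
  · rw [weightFunctional_apply, h, Pi.mul_apply, Pi.mul_apply, ha, hb, zero_mul, zero_mul,
      sub_zero]
  · rw [hσ x hx, eval_add, eval_mul, eval_mul]
    ring

/-- The weight function `(x (l - x)) ^ (α - 1/2)` of the shifted Gegenbauer polynomials on
`[0, l]`. -/
def gegenbauerWeight (α l x : ℝ) : ℝ :=
  (x * (l - x)) ^ (α - 1 / 2)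

section Shifted

variable {α l : ℝ}

theorem gegenbauerWeight_pos {x : ℝ} (hx : x ∈ Ioo 0 l) : 0 < gegenbauerWeight α l x :=
  Real.rpow_pos_of_pos (mul_pos hx.1 (sub_pos.2 hx.2)) _

theorem intervalIntegrable_gegenbauerWeight (hα : -(1 / 2) < α) (hl : 0 < l) :
    IntervalIntegrable (gegenbauerWeight α l) volume 0 l := by
  have hleft : IntervalIntegrable (gegenbauerWeight α l) volume 0 (l / 2) := by
    have hcont : ContinuousOn (fun x => (l - x) ^ (α - 1 / 2)) (uIcc 0 (l / 2)) := by
      refine ContinuousOn.rpow_const (by fun_prop) fun x hx => Or.inl ?_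
      rw [uIcc_of_le (by linarith)] at hx
      linarith [hx.2]
    have hpow : IntervalIntegrable (fun x => x ^ (α - 1 / 2)) volume 0 (l / 2) :=
      intervalIntegral.intervalIntegrable_rpow' (by linarith)
    refine (hpow.mul_continuousOn hcont).congr fun x hx => ?_
    rw [uIoc_of_le (by linarith)] at hx
    exact (Real.mul_rpow hx.1.le (by linarith [hx.2])).symm
  have hright := (hleft.comp_sub_left l).symm
  rw [sub_zero, sub_half] at hright
  refine hleft.trans (hright.congr fun x _ => ?_)
  rw [gegenbauerWeight, gegenbauerWeight, sub_sub_cancel, mul_comm]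

theorem satisfiesPearson_gegenbauerWeight (hα : -(1 / 2) < α) (hl : 0 < l) :
    SatisfiesPearson (weightFunctional (intervalIntegrable_gegenbauerWeight hα hl))
      (X * (C l - X)) (C (α + 1 / 2) * (C l - 2 * X)) := by
  have hα' : 0 < α + 1 / 2 := by linarith
  have hne {x : ℝ} (hx : x ∈ Ioo 0 l) : x * (l - x) ≠ 0 := (mul_pos hx.1 (sub_pos.2 hx.2)).ne'
  refine satisfiesPearson_weightFunctional (W := fun x => (x * (l - x)) ^ (α + 1 / 2)) hl.le _
    (Continuous.continuousOn (Continuous.rpow_const (by fun_prop) fun _ => Or.inr hα'.le))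
    (by rw [zero_mul, Real.zero_rpow hα'.ne']) (by rw [sub_self, mul_zero, Real.zero_rpow hα'.ne'])
    (fun x hx => ?_) fun x hx => ?_
  · rw [show α + 1 / 2 = (α - 1 / 2) + 1 by ring, Real.rpow_add_one (hne hx), mul_comm]
    simp [gegenbauerWeight]
  · refine ((((hasDerivAt_id' x).mul ((hasDerivAt_id' x).const_sub l)).rpow_const
      (p := α + 1 / 2) (Or.inl (hne hx)))).congr_deriv ?_
    simp only [Pi.mul_apply, eval_mul, eval_sub, eval_C, eval_X, eval_ofNat, gegenbauerWeight]
    rw [show α + 1 / 2 - 1 = α - 1 / 2 by ring]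
    ring

theorem shiftedGegenbauer_eval (α l : ℝ) (m : ℕ) (x : ℝ) :
    (shiftedGegenbauer α l m).eval x = (gegenbauer α m).eval (2 / l * x - 1) := by
  simp [shiftedGegenbauer, eval_comp]

theorem derivative_shiftedGegenbauer (α l : ℝ) (m : ℕ) :
    derivative (shiftedGegenbauer α l m) =
      C (2 / l) * (derivative (gegenbauer α m)).comp (C (2 / l) * X - 1) := by
  simp [shiftedGegenbauer, derivative_comp]

theorem derivative_shiftedGegenbauer_eval (α l : ℝ) (m : ℕ) (x : ℝ) :
    (derivative (shiftedGegenbauer α l m)).eval x =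
      2 / l * (derivative (gegenbauer α m)).eval (2 / l * x - 1) := by
  simp [derivative_shiftedGegenbauer, eval_comp]

theorem derivative_derivative_shiftedGegenbauer_eval (α l : ℝ) (m : ℕ) (x : ℝ) :
    (derivative (derivative (shiftedGegenbauer α l m))).eval x =
      (2 / l) ^ 2 * (derivative (derivative (gegenbauer α m))).eval (2 / l * x - 1) := by
  simp [derivative_shiftedGegenbauer, derivative_comp, eval_comp, sq, mul_assoc]

theorem shiftedGegenbauer_ode (hα : -(1 / 2) < α) (hl : 0 < l) (m : ℕ) :
    X * (C l - X) * derivative (derivative (shiftedGegenbauer α l m)) +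
      C (α + 1 / 2) * (C l - 2 * X) * derivative (shiftedGegenbauer α l m) +
      C ((m : ℝ) * (m + 2 * α)) * shiftedGegenbauer α l m = 0 := by
  refine funext fun x => ?_
  have hode := congrArg (eval (2 / l * x - 1)) (gegenbauer_ode hα m)
  simp only [eval_add, eval_sub, eval_mul, eval_pow, eval_C, eval_X, eval_one, eval_ofNat,
    eval_zero, shiftedGegenbauer_eval, derivative_shiftedGegenbauer_eval,
    derivative_derivative_shiftedGegenbauer_eval] at hode ⊢
  rw [← hode]
  field_simp
  ring

theorem natDegree_C_mul_X_sub_one (hl : 0 < l) : (C (2 / l) * X - 1 : ℝ[X]).natDegree = 1 := by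
  simpa [sub_eq_add_neg] using natDegree_linear (a := 2 / l) (b := -1) (by positivity)

theorem leadingCoeff_C_mul_X_sub_one (hl : 0 < l) :
    (C (2 / l) * X - 1 : ℝ[X]).leadingCoeff = 2 / l := by
  simpa [sub_eq_add_neg] using leadingCoeff_linear (a := 2 / l) (b := -1) (by positivity)

theorem natDegree_shiftedGegenbauer (hα : -(1 / 2) < α) (hl : 0 < l) (m : ℕ) :
    (shiftedGegenbauer α l m).natDegree = m := by
  rw [shiftedGegenbauer, natDegree_comp, natDegree_C_mul_X_sub_one hl, natDegree_gegenbauer hα,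
    mul_one]

theorem leadingCoeff_shiftedGegenbauer (hα : -(1 / 2) < α) (hl : 0 < l) (m : ℕ) :
    (shiftedGegenbauer α l m).leadingCoeff = (gegenbauer α m).leadingCoeff * (2 / l) ^ m := by
  have hdeg : (C (2 / l) * X - 1 : ℝ[X]).natDegree ≠ 0 := by simp [natDegree_C_mul_X_sub_one hl]
  rw [shiftedGegenbauer, leadingCoeff_comp hdeg, leadingCoeff_C_mul_X_sub_one hl,
    natDegree_gegenbauer hα]

theorem leadingCoeff_shiftedGegenbauer_pos (hα : -(1 / 2) < α) (hl : 0 < l) (m : ℕ) :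
    0 < (shiftedGegenbauer α l m).leadingCoeff := by
  have := leadingCoeff_gegenbauer_pos hα m
  rw [leadingCoeff_shiftedGegenbauer hα hl]
  positivity

theorem shiftedGegenbauer_ne_zero (hα : -(1 / 2) < α) (hl : 0 < l) (m : ℕ) :
    shiftedGegenbauer α l m ≠ 0 :=
  leadingCoeff_ne_zero.1 (leadingCoeff_shiftedGegenbauer_pos hα hl m).ne'

theorem degree_shiftedGegenbauer (hα : -(1 / 2) < α) (hl : 0 < l) (m : ℕ) :
    (shiftedGegenbauer α l m).degree = m := by
  rw [degree_eq_natDegree (shiftedGegenbauer_ne_zero hα hl m), natDegree_shiftedGegenbauer hα hl]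

theorem eigenvalue_injective (hα : -(1 / 2) < α) :
    Function.Injective fun m : ℕ => (m : ℝ) * (m + 2 * α) := by
  intro m k hmk
  by_contra hne
  have hsum : (1 : ℝ) ≤ m + k := by
    exact_mod_cast (show 1 ≤ m + k by omega)
  have hmul : ((m : ℝ) - k) * (m + k + 2 * α) = 0 := by
    dsimp only at hmk
    linear_combination hmk
  rcases mul_eq_zero.1 hmul with h | h
  · exact hne (Nat.cast_injective (sub_eq_zero.1 h))
  · linarith

theorem isOrthogonal_shiftedGegenbauer (hα : -(1 / 2) < α) (hl : 0 < l) (m : ℕ) :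
    IsOrthogonal (weightFunctional (intervalIntegrable_gegenbauerWeight hα hl))
      (shiftedGegenbauer α l m) :=
  isOrthogonal_of_pairwise ⟨shiftedGegenbauer α l, degree_shiftedGegenbauer hα hl⟩
    (fun j k hjk => (satisfiesPearson_gegenbauerWeight hα hl).map_mul_eq_zero
      ((eigenvalue_injective hα).ne hjk) (shiftedGegenbauer_ode hα hl j)
      (shiftedGegenbauer_ode hα hl k)) m

theorem isPositiveOn_gegenbauerWeight (hα : -(1 / 2) < α) (hl : 0 < l) :
    IsPositiveOn (weightFunctional (intervalIntegrable_gegenbauerWeight hα hl)) (Ioo 0 l) :=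
  isPositiveOn_weightFunctional hl _ fun _ hx => gegenbauerWeight_pos hx

/-! ### Gauss nodes, Christoffel numbers and barycentric weights -/

theorem card_toFinset_roots_shiftedGegenbauer (hα : -(1 / 2) < α) (hl : 0 < l) (m : ℕ) :
    (shiftedGegenbauer α l m).roots.toFinset.card = m :=
  ((isOrthogonal_shiftedGegenbauer hα hl m).card_toFinset_roots
    (isPositiveOn_gegenbauerWeight hα hl) ordConnected_Ioo
    (shiftedGegenbauer_ne_zero hα hl m)).trans (natDegree_shiftedGegenbauer hα hl m)

theorem node_eq_orderEmbOfFin (hα : -(1 / 2) < α) (hl : 0 < l) (n : ℕ) :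
    node α l n = (shiftedGegenbauer α l (n + 1)).roots.toFinset.orderEmbOfFin
      (card_toFinset_roots_shiftedGegenbauer hα hl (n + 1)) := by
  ext i
  rw [Finset.orderEmbOfFin_apply]
  exact List.getD_eq_getElem ..

theorem strictMono_node (hα : -(1 / 2) < α) (hl : 0 < l) (n : ℕ) : StrictMono (node α l n) := by
  rw [node_eq_orderEmbOfFin hα hl]
  exact OrderEmbedding.strictMono _

theorem isRoot_node (hα : -(1 / 2) < α) (hl : 0 < l) (n : ℕ) (i : Fin (n + 1)) :
    (shiftedGegenbauer α l (n + 1)).IsRoot (node α l n i) := by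
  rw [node_eq_orderEmbOfFin hα hl]
  exact isRoot_of_mem_roots (Multiset.mem_toFinset.1 (Finset.orderEmbOfFin_mem _ _ i))

theorem node_mem_Ioo (hα : -(1 / 2) < α) (hl : 0 < l) (n : ℕ) (i : Fin (n + 1)) :
    node α l n i ∈ Ioo 0 l :=
  (isOrthogonal_shiftedGegenbauer hα hl (n + 1)).mem_of_isRoot (isPositiveOn_gegenbauerWeight hα hl)
    ordConnected_Ioo (shiftedGegenbauer_ne_zero hα hl _) (isRoot_node hα hl n i)

theorem shiftedGegenbauer_eq_C_mul_nodal (hα : -(1 / 2) < α) (hl : 0 < l) (n : ℕ) :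
    shiftedGegenbauer α l (n + 1) =
      C (shiftedGegenbauer α l (n + 1)).leadingCoeff * Lagrange.nodal Finset.univ (node α l n) := by
  have hlc := (leadingCoeff_shiftedGegenbauer_pos hα hl (n + 1)).ne'
  refine eq_of_degree_le_of_eval_index_eq (v := node α l n) Finset.univ
    (strictMono_node hα hl n).injective.injOn ?_ ?_ ?_ fun i hi => ?_
  · simp [degree_shiftedGegenbauer hα hl]
  · simp [degree_shiftedGegenbauer hα hl, degree_C_mul hlc]
  · rw [leadingCoeff_mul, leadingCoeff_C, Lagrange.nodal_monic.leadingCoeff, mul_one]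
  · rw [(isRoot_node hα hl n i).eq_zero, eval_mul, Lagrange.eval_nodal_at_node hi, mul_zero]

theorem isOrthogonal_nodal_node (hα : -(1 / 2) < α) (hl : 0 < l) (n : ℕ) :
    IsOrthogonal (weightFunctional (intervalIntegrable_gegenbauerWeight hα hl))
      (Lagrange.nodal Finset.univ (node α l n)) := by
  intro q hq
  have hlc := (leadingCoeff_shiftedGegenbauer_pos hα hl (n + 1)).ne'
  have h := isOrthogonal_shiftedGegenbauer hα hl (n + 1) q
    (by simpa [degree_shiftedGegenbauer hα hl] using hq)
  rw [shiftedGegenbauer_eq_C_mul_nodal hα hl, mul_assoc, ← smul_eq_C_mul, map_smul,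
    smul_eq_mul] at h
  exact (mul_eq_zero.1 h).resolve_left hlc

theorem christoffel_eq (hα : -(1 / 2) < α) (hl : 0 < l) (n : ℕ) (j : Fin (n + 1)) :
    christoffel α l n j = Lagrange.nodalWeight Finset.univ (node α l n) j *
      weightFunctional (intervalIntegrable_gegenbauerWeight hα hl)
        (Lagrange.nodal (Finset.univ.erase j) (node α l n)) := by
  rw [← smul_eq_mul, ← map_smul, smul_eq_C_mul,
    Lagrange.nodal_erase_eq_nodal_div (Finset.mem_univ j),
    ← Lagrange.basis_eq_prod_sub_inv_mul_nodal_div (Finset.mem_univ j)]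
  rfl

theorem derivative_shiftedGegenbauer_eval_node (hα : -(1 / 2) < α) (hl : 0 < l) (n : ℕ)
    (j : Fin (n + 1)) :
    (derivative (shiftedGegenbauer α l (n + 1))).eval (node α l n j) =
      (shiftedGegenbauer α l (n + 1)).leadingCoeff /
        Lagrange.nodalWeight Finset.univ (node α l n) j := by
  rw [Lagrange.nodalWeight_eq_eval_derivative_nodal (Finset.mem_univ j), div_inv_eq_mul]
  conv_lhs => rw [shiftedGegenbauer_eq_C_mul_nodal hα hl, derivative_C_mul, eval_mul, eval_C]

theorem node_mul_sub_node_mul_derivative (hα : -(1 / 2) < α) (hl : 0 < l) (n : ℕ)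
    (j : Fin (n + 1)) :
    2 / l * (node α l n j * (l - node α l n j)) *
        (derivative (shiftedGegenbauer α l (n + 1))).eval (node α l n j) =
      ((n : ℝ) + 1) * (shiftedGegenbauer α l n).eval (node α l n j) := by
  have h := congrArg (eval (2 / l * node α l n j - 1)) (gegenbauer_structure_relations hα n).1
  simp only [eval_mul, eval_sub, eval_pow, eval_X, eval_one, eval_C, ← shiftedGegenbauer_eval,
    (isRoot_node hα hl n j).eq_zero, mul_zero, sub_zero] at h
  rw [← h, derivative_shiftedGegenbauer_eval]
  field_simp
  ring

theorem exists_christoffel_eq_mul_sq (hα : -(1 / 2) < α) (hl : 0 < l) (n : ℕ) :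
    ∃ c : ℝ, 0 < c ∧ ∀ j, (l - node α l n j) * node α l n j * christoffel α l n j =
      c * Lagrange.nodalWeight Finset.univ (node α l n) j ^ 2 := by
  set φ := weightFunctional (intervalIntegrable_gegenbauerWeight hα hl)
  set p := shiftedGegenbauer α l n
  set K := (shiftedGegenbauer α l (n + 1)).leadingCoeff
  have hp : p ≠ 0 := shiftedGegenbauer_ne_zero hα hl n
  have hlc : 0 < p.leadingCoeff := leadingCoeff_shiftedGegenbauer_pos hα hl n
  have hK : 0 < K := leadingCoeff_shiftedGegenbauer_pos hα hl (n + 1)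
  have := (isPositiveOn_gegenbauerWeight hα hl).map_mul_self_pos hp
  refine ⟨((n : ℝ) + 1) * l * φ (p * p) / (2 * K * p.leadingCoeff), by positivity, fun j => ?_⟩
  have hw : Lagrange.nodalWeight Finset.univ (node α l n) j ≠ 0 :=
    Lagrange.nodalWeight_ne_zero (strictMono_node hα hl n).injective.injOn (Finset.mem_univ j)
  have hnorm : p.leadingCoeff * (p.eval (node α l n j) *
      φ (Lagrange.nodal (Finset.univ.erase j) (node α l n))) = φ (p * p) := by
    rw [← (isOrthogonal_nodal_node hα hl n).map_nodal_erase_mul (Finset.mem_univ j)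
      (by simp [p, natDegree_shiftedGegenbauer hα hl]), mul_comm (Lagrange.nodal _ _) p]
    exact (isOrthogonal_shiftedGegenbauer hα hl n).leadingCoeff_mul_map_mul hp
      Lagrange.nodal_monic (by simp [degree_shiftedGegenbauer hα hl])
  have hstructure := node_mul_sub_node_mul_derivative hα hl n j
  rw [derivative_shiftedGegenbauer_eval_node hα hl] at hstructure
  rw [christoffel_eq hα hl, ← hnorm]
  field_simp at hstructure ⊢
  linear_combination φ (Lagrange.nodal (Finset.univ.erase j) (node α l n)) * hstructure

theorem neg_one_pow_mul_nodalWeight_pos {n : ℕ} {v : Fin (n + 1) → ℝ} (hv : StrictMono v)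
    (j : Fin (n + 1)) : 0 < (-1) ^ (n + (j : ℕ)) * Lagrange.nodalWeight Finset.univ v j := by
  have hfactor : ∀ k ∈ Finset.univ.erase j,
      (v j - v k)⁻¹ = (if j < k then (-1 : ℝ) else 1) * |v j - v k|⁻¹ := by
    intro k hk
    split_ifs with hjk
    · rw [abs_of_neg (sub_neg.2 (hv hjk)), inv_neg, neg_one_mul, neg_neg]
    · have hkj : k < j := lt_of_le_of_ne (not_lt.1 hjk) (Finset.ne_of_mem_erase hk)
      rw [abs_of_pos (sub_pos.2 (hv hkj)), one_mul]
  have hlarger : (Finset.univ.erase j).filter (fun k => j < k) = Finset.Ioi j := by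
    ext k
    simpa using fun h : j < k => h.ne'
  have heven : Even (n + (j : ℕ) + (n + 1 - 1 - (j : ℕ))) := ⟨n, by omega⟩
  rw [Lagrange.nodalWeight, Finset.prod_congr rfl hfactor, Finset.prod_mul_distrib,
    Finset.prod_ite, hlarger, Finset.prod_const, Finset.prod_const_one, Fin.card_Ioi, mul_one,
    ← mul_assoc, ← pow_add, heven.neg_one_pow, one_mul]
  exact Finset.prod_pos fun k hk => inv_pos.2 (abs_pos.2 (sub_ne_zero.2
    (hv.injective.ne (Finset.ne_of_mem_erase hk).symm)))

theorem exists_baryWeight_eq_mul_nodalWeight (hα : -(1 / 2) < α) (hl : 0 < l) (n : ℕ) :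
    ∃ c : ℝ, c ≠ 0 ∧ ∀ j, baryWeight α l n j =
      c * Lagrange.nodalWeight Finset.univ (node α l n) j := by
  obtain ⟨c, hc, h⟩ := exists_christoffel_eq_mul_sq hα hl n
  set d := (4 : ℝ) ^ α * l ^ (-2 * (1 + α)) * c
  have hd0 : 0 < d := by positivity
  refine ⟨2 * √d * (-1) ^ n, by positivity, fun j => ?_⟩
  have hradicand : (4 : ℝ) ^ α * l ^ (-2 * (1 + α)) * (l - node α l n j) * node α l n j *
      christoffel α l n j =
        d * ((-1) ^ (n + (j : ℕ)) * Lagrange.nodalWeight Finset.univ (node α l n) j) ^ 2 := by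
    rw [mul_pow, ← pow_mul, (even_two.mul_left _).neg_one_pow]
    linear_combination ((4 : ℝ) ^ α * l ^ (-2 * (1 + α))) * h j
  have hsign : ((-1 : ℝ) ^ (j : ℕ)) * (-1) ^ (j : ℕ) = 1 := by
    rw [← mul_pow, neg_one_mul, neg_neg, one_pow]
  rw [baryWeight, hradicand, Real.sqrt_mul hd0.le,
    Real.sqrt_sq (neg_one_pow_mul_nodalWeight_pos (strictMono_node hα hl n) j).le, pow_add]
  linear_combination 2 * √d * (-1) ^ n * Lagrange.nodalWeight Finset.univ (node α l n) j * hsign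

theorem div_sum_div_eq_eval_basis {ι : Type*} [DecidableEq ι] {s : Finset ι} {v ξ : ι → ℝ}
    {c x : ℝ} (hv : InjOn v s) (hc : c ≠ 0) (hξ : ∀ k, ξ k = c * Lagrange.nodalWeight s v k)
    (hx : ∀ k ∈ s, x ≠ v k) {j : ι} (hj : j ∈ s) :
    ξ j / (x - v j) / ∑ k ∈ s, ξ k / (x - v k) = (Lagrange.basis s v j).eval x := by
  have hs : s.Nonempty := ⟨j, hj⟩
  have hne := Lagrange.sum_nodalWeight_mul_inv_sub_ne_zero hv hx hs
  have hone := Lagrange.eval_interpolate_not_at_node 1 hx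
  rw [Lagrange.interpolate_one hv hs, eval_one] at hone
  simp only [Pi.one_apply, mul_one] at hone
  rw [Lagrange.eval_basis_not_at_node hj (hx j hj)]
  simp only [hξ, mul_div_assoc, ← Finset.mul_sum]
  simp only [← div_eq_mul_inv] at hone hne ⊢
  rw [← mul_div_assoc, mul_div_mul_left _ _ hc, div_eq_iff hne, mul_right_comm, ← hone, one_mul]

theorem baryLagrange_eq_eval_basis (hα : -(1 / 2) < α) (hl : 0 < l) (n : ℕ) (j : Fin (n + 1))
    (x : ℝ) :
    baryLagrange α l n j x = (Lagrange.basis Finset.univ (node α l n) j).eval x := by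
  have hinj : InjOn (node α l n) (Finset.univ : Finset (Fin (n + 1))) :=
    (strictMono_node hα hl n).injective.injOn
  rw [baryLagrange]
  split_ifs with hself hnode
  · rw [hself, Lagrange.eval_basis_self hinj (Finset.mem_univ j)]
  · obtain ⟨k, rfl⟩ := hnode
    rw [Lagrange.eval_basis_of_ne (fun h => hself (by rw [h])) (Finset.mem_univ k)]
  · obtain ⟨c, hc, hξ⟩ := exists_baryWeight_eq_mul_nodalWeight hα hl n
    exact div_sum_div_eq_eval_basis hinj hc hξ (fun k _ h => hnode ⟨k, h⟩) (Finset.mem_univ j)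

end Shifted

/-! ### The truncation error -/

section InterpolationIntegral

variable {ι : Type*} {s : Finset ι} {v : ι → ℝ} {a b B : ℝ}

theorem integral_abs_nodal_lt {j : ι} (hj : j ∈ s) (haj : a < v j) (hB : 0 < B)
    (hbound : ∀ y ∈ Icc a (v j), |(Lagrange.nodal s v).eval y| ≤ B) :
    ∫ y in a..v j, |(Lagrange.nodal s v).eval y| < B * (v j - a) := by
  have h := intervalIntegral.integral_lt_integral_of_continuousOn_of_le_of_exists_lt
    (g := fun _ => B) haj (Polynomial.continuous (Lagrange.nodal s v)).abs.continuousOn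
    continuousOn_const (fun y hy => hbound y (Ioc_subset_Icc_self hy))
    ⟨v j, right_mem_Icc.2 haj.le, by rwa [Lagrange.eval_nodal_at_node hj, abs_zero]⟩
  rwa [intervalIntegral.integral_const, smul_eq_mul, mul_comm] at h

theorem abs_integral_sub_eval_interpolate_lt [DecidableEq ι] {n : ℕ} {A : ℝ} {g : ℝ → ℝ}
    (hg : ContDiffOn ℝ ((n + 1 : ℕ) : WithTop ℕ∞) g (Icc a b)) (hv : InjOn v s)
    (hs : s.card = n + 1) (hvm : ∀ i ∈ s, v i ∈ Icc a b) (hA0 : 0 < A)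
    (hA : ∀ x ∈ Ioo a b, |iteratedDerivWithin (n + 1) g (Icc a b) x| ≤ A) (hB : 0 < B)
    (hbound : ∀ y ∈ Icc a b, |(Lagrange.nodal s v).eval y| ≤ B) {j : ι} (hj : j ∈ s)
    (haj : a < v j) :
    |∫ y in a..v j, (g y - (Lagrange.interpolate s v fun i => g (v i)).eval y)| <
      A / ((n + 1).factorial : ℝ) * (B * (v j - a)) := by
  have hjb : v j ≤ b := (hvm j hj).2
  have hle : |∫ y in a..v j, (g y - (Lagrange.interpolate s v fun i => g (v i)).eval y)| ≤
      ∫ y in a..v j, A / ((n + 1).factorial : ℝ) * |(Lagrange.nodal s v).eval y| := by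
    rw [← Real.norm_eq_abs]
    refine intervalIntegral.norm_integral_le_of_norm_le haj.le
      (Filter.Eventually.of_forall fun y hy => ?_)
      (Continuous.intervalIntegrable (continuous_const.mul (Polynomial.continuous _).abs) _ _)
    exact abs_sub_eval_interpolate_le (haj.trans_le hjb) hg hv hs hvm hA
      ⟨hy.1.le, hy.2.trans hjb⟩
  refine hle.trans_lt ?_
  rw [intervalIntegral.integral_const_mul]
  exact mul_lt_mul_of_pos_left
    (integral_abs_nodal_lt hj haj hB fun y hy => hbound y ⟨hy.1, hy.2.trans hjb⟩) (by positivity)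

end InterpolationIntegral

section TruncError

variable {α l : ℝ}

theorem truncError_succ_eq_integral (hα : -(1 / 2) < α) (hl : 0 < l) {n : ℕ} (q : ℕ) {f : ℝ → ℝ}
    (hf : ContinuousOn f (Icc 0 l)) (i : Fin (n + 1)) :
    truncError α l n (q + 1) f i = (∫ y in (0 : ℝ)..node α l n i,
      ((node α l n i - y) ^ q * f y - (Lagrange.interpolate Finset.univ (node α l n)
        fun j => (node α l n i - node α l n j) ^ q * f (node α l n j)).eval y)) /
          (q.factorial : ℝ) := by
  have hx := node_mem_Ioo hα hl n i
  have hf' : ContinuousOn f (uIcc 0 (node α l n i)) := by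
    refine hf.mono ?_
    rw [uIcc_of_le hx.1.le]
    exact Icc_subset_Icc_right hx.2.le
  have hint : IntervalIntegrable (fun y => (node α l n i - y) ^ q * f y) volume 0
      (node α l n i) :=
    ContinuousOn.intervalIntegrable ((Continuous.continuousOn (by fun_prop)).mul hf')
  rw [intervalIntegral.integral_sub hint ((Polynomial.continuous _).intervalIntegrable _ _),
    sub_div, truncError, iterIntegral_succ_eq hf' q]
  congr 1
  · rw [← intervalIntegral.integral_div]
    congr 1
    funext y
    ring
  · simp only [Matrix.mulVec, dotProduct, intMatrix, Matrix.of_apply, Nat.add_sub_cancel,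
      baryLagrange_eq_eval_basis hα hl, Lagrange.interpolate_apply, eval_finsetSum, eval_mul,
      eval_C]
    rw [intervalIntegral.integral_finsetSum fun j _ => Continuous.intervalIntegrable
      (by fun_prop) _ _, Finset.sum_div]
    refine Finset.sum_congr rfl fun j _ => ?_
    rw [intervalIntegral.integral_const_mul]
    ring

theorem abs_nodal_node_le (hα : -(1 / 2) < α) (hl : 0 < l) {n : ℕ} {M : ℝ}
    (hM : ∀ t : ℝ, |t| ≤ 1 → |(gegenbauer α (n + 1)).eval t| ≤ M) {y : ℝ} (hy : y ∈ Icc 0 l) :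
    |(Lagrange.nodal Finset.univ (node α l n)).eval y| ≤
      M / (shiftedGegenbauer α l (n + 1)).leadingCoeff := by
  have hK := leadingCoeff_shiftedGegenbauer_pos hα hl (n + 1)
  have ht : |2 / l * y - 1| ≤ 1 := by
    have hyl : y / l ≤ 1 := (div_le_one hl).2 hy.2
    have := div_nonneg hy.1 hl.le
    rw [abs_le, div_mul_eq_mul_div, mul_div_assoc]
    constructor <;> linarith
  rw [le_div_iff₀ hK, mul_comm, ← abs_of_pos hK, ← abs_mul, ← eval_C_mul,
    ← shiftedGegenbauer_eq_C_mul_nodal hα hl, shiftedGegenbauer_eval]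
  exact hM _ ht

theorem Gamma_add_natCast {z : ℝ} (hz : ∀ k : ℕ, z ≠ -k) (n : ℕ) :
    Real.Gamma (z + n) = Real.Gamma z * (ascPochhammer ℝ n).eval z := by
  induction n with
  | zero => simp
  | succ n ih =>
    have hzn : z + n ≠ 0 := fun h => hz n (eq_neg_of_add_eq_zero_left h)
    rw [Nat.cast_add_one, ← add_assoc, Real.Gamma_add_one hzn, ih, ascPochhammer_succ_eval]
    ring

theorem ne_neg_natCast_of_pos {z : ℝ} (hz : 0 < z) (k : ℕ) : z ≠ -k := by
  have : (0 : ℝ) ≤ k := k.cast_nonneg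
  linarith

/-- The quantity `2 ^ n / ((n + 1)! K)`, where `K` is the leading coefficient of the Gegenbauer
polynomial of degree `n + 1`, written with Gamma functions: the constant of the quadrature error
apart from powers of `2`. -/
def errorRatio (α : ℝ) (n : ℕ) : ℝ :=
  Real.Gamma (α + 1) * Real.Gamma (n + 2 * α + 1) /
    (Real.Gamma (2 * α + 1) * Real.Gamma (n + 2) * Real.Gamma (n + α + 1))

theorem errorRatio_eq_ascPochhammer (hα : -(1 / 2) < α) (n : ℕ) :
    errorRatio α n = (ascPochhammer ℝ n).eval (2 * α + 1) / (ascPochhammer ℝ n).eval (α + 1) /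
      ((n + 1).factorial : ℝ) := by
  have h1 : 0 < α + 1 := by linarith
  have h2 : 0 < 2 * α + 1 := by linarith
  have := Real.Gamma_pos_of_pos h1
  have := Real.Gamma_pos_of_pos h2
  have := ascPochhammer_pos n _ h1
  rw [errorRatio, show (n : ℝ) + 2 * α + 1 = 2 * α + 1 + n by ring,
    show (n : ℝ) + α + 1 = α + 1 + n by ring,
    show (n : ℝ) + 2 = ((n + 1 : ℕ) : ℝ) + 1 by push_cast; ring,
    Gamma_add_natCast (ne_neg_natCast_of_pos h1), Gamma_add_natCast (ne_neg_natCast_of_pos h2),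
    Real.Gamma_nat_eq_factorial, div_div, div_eq_div_iff (by positivity) (by positivity)]
  ring

theorem errorRatio_mul_leadingCoeff_gegenbauer (hα : -(1 / 2) < α) (n : ℕ) :
    errorRatio α n * (((n + 1).factorial : ℝ) * (gegenbauer α (n + 1)).leadingCoeff) = 2 ^ n := by
  have := ascPochhammer_pos n _ (show 0 < α + 1 by linarith)
  have := ascPochhammer_pos n _ (show 0 < 2 * α + 1 by linarith)
  rw [errorRatio_eq_ascPochhammer hα, leadingCoeff_gegenbauer_succ hα]
  field_simp

theorem abs_truncError_lt (hα : -(1 / 2) < α) (hl : 0 < l) {n q : ℕ} (hq : 1 ≤ q) {f : ℝ → ℝ}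
    (hf : ContDiffOn ℝ ((n + 1 : ℕ) : WithTop ℕ∞) f (Icc 0 l)) {i : Fin (n + 1)} {A M : ℝ}
    (hA0 : 0 < A) (hA : ∀ x ∈ Ioo 0 l, |iteratedDerivWithin (n + 1)
      (fun y => (node α l n i - y) ^ (q - 1) * f y) (Icc 0 l) x| ≤ A)
    (hM : ∀ t : ℝ, |t| ≤ 1 → |(gegenbauer α (n + 1)).eval t| ≤ M) :
    |truncError α l n q f i| < A * node α l n i * l ^ (n + 1) /
      (((q - 1).factorial : ℝ) * 2 ^ (2 * n + 1)) * (errorRatio α n * M) := by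
  obtain ⟨q, rfl⟩ := Nat.exists_eq_add_of_le' hq
  rw [Nat.add_sub_cancel] at hA ⊢
  have hM0 : 0 < M := by
    have h := hM 1 abs_one.le
    rw [gegenbauer_eval_one hα, abs_one] at h
    linarith
  have hK := leadingCoeff_gegenbauer_pos hα (n + 1)
  have hlt := abs_integral_sub_eval_interpolate_lt (s := Finset.univ) (v := node α l n) (j := i)
    ((ContDiff.contDiffOn (by fun_prop)).mul hf) (strictMono_node hα hl n).injective.injOn
    (by simp) (fun j _ => Ioo_subset_Icc_self (node_mem_Ioo hα hl n j)) hA0 hA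
    (div_pos hM0 (leadingCoeff_shiftedGegenbauer_pos hα hl (n + 1)))
    (fun y hy => abs_nodal_node_le hα hl hM hy) (Finset.mem_univ i) (node_mem_Ioo hα hl n i).1
  rw [truncError_succ_eq_integral hα hl q hf.continuousOn, abs_div, Nat.abs_cast,
    div_lt_iff₀ (by positivity)]
  refine hlt.trans_eq ?_
  rw [leadingCoeff_shiftedGegenbauer hα hl, eq_div_of_mul_eq (by positivity)
    (errorRatio_mul_leadingCoeff_gegenbauer hα n), div_pow]
  field_simp
  ring

end TruncError

/-! ### Closed forms of the error constants -/

section ClosedForms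

theorem ascPochhammer_two_mul_eval {K : Type*} [Field K] [CharZero K] (z : K) (k : ℕ) :
    (ascPochhammer K (2 * k)).eval (2 * z) =
      4 ^ k * (ascPochhammer K k).eval z * (ascPochhammer K k).eval (z + 1 / 2) := by
  induction k with
  | zero => simp
  | succ k ih =>
    rw [mul_add_one, ascPochhammer_succ_eval, ascPochhammer_succ_eval, ih,
      ascPochhammer_succ_eval, ascPochhammer_succ_eval]
    push_cast
    ring

theorem factorial_two_mul (k : ℕ) :
    ((2 * k).factorial : ℝ) = 4 ^ k * (ascPochhammer ℝ k).eval (1 / 2) * (k.factorial : ℝ) := by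
  have h := ascPochhammer_two_mul_eval (1 / 2 : ℝ) k
  rwa [mul_one_div_cancel two_ne_zero, add_halves, ascPochhammer_eval_one,
    ascPochhammer_eval_one] at h

theorem choose_add_sub_one_eq (r : ℝ) (k : ℕ) :
    Ring.choose (k + r - 1) k = (ascPochhammer ℝ k).eval r / (k.factorial : ℝ) := by
  rw [eq_div_iff (by positivity), mul_comm, ← ascPochhammer_smeval_eq_eval,
    ← Ring.factorial_nsmul_multichoose_eq_ascPochhammer, Ring.multichoose_eq, nsmul_eq_mul,
    add_comm r]

variable {α : ℝ}

theorem ascPochhammer_half_div_eq_choose (hα : -(1 / 2) < α) (k : ℕ) :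
    (ascPochhammer ℝ k).eval (1 / 2) / (ascPochhammer ℝ k).eval (α + 1 / 2) =
      ((2 * k).factorial : ℝ) * Ring.choose (k + α) k /
        (ascPochhammer ℝ (2 * k)).eval (2 * α + 1) := by
  have := ascPochhammer_pos k _ (show 0 < α + 1 / 2 by linarith)
  have := ascPochhammer_pos k _ (show 0 < α + 1 by linarith)
  have hchoose := choose_add_sub_one_eq (α + 1) k
  have hdup := ascPochhammer_two_mul_eval (α + 1 / 2) k
  rw [show (k : ℝ) + (α + 1) - 1 = k + α by ring] at hchoose
  rw [show 2 * (α + 1 / 2) = 2 * α + 1 by ring, show α + 1 / 2 + 1 / 2 = α + 1 by ring] at hdup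
  rw [factorial_two_mul, hchoose, hdup]
  field_simp

theorem ne_neg_natCast_of_Ioo {z : ℝ} (hz : z ∈ Ioo (-1) 0) (k : ℕ) : z ≠ -k := by
  rintro rfl
  rcases k.eq_zero_or_pos with rfl | hk
  · simp at hz
  · have : (1 : ℝ) ≤ k := by exact_mod_cast hk
    linarith [hz.1]

theorem ascPochhammer_half_div_eq_choose_sub_one (hα : α ∈ Ioo (-(1 / 2)) 0) (k : ℕ) :
    (ascPochhammer ℝ k).eval (1 / 2) / (ascPochhammer ℝ k).eval (α + 1 / 2) =
      ((2 * k).factorial : ℝ) * Real.Gamma (2 * α) / Real.Gamma (2 * k + 2 * α) *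
        Ring.choose (k + α - 1) k := by
  have hα1 : ∀ j : ℕ, α ≠ -j := ne_neg_natCast_of_Ioo ⟨by linarith [hα.1], hα.2⟩
  have hα2 : ∀ j : ℕ, 2 * α ≠ -j := ne_neg_natCast_of_Ioo ⟨by linarith [hα.1], by linarith [hα.2]⟩
  have := ascPochhammer_pos k _ (show 0 < α + 1 / 2 by linarith [hα.1])
  have hΓ : Real.Gamma (2 * α) ≠ 0 := Real.Gamma_ne_zero hα2
  have hpoch : (ascPochhammer ℝ k).eval α ≠ 0 := by
    have h := Real.Gamma_ne_zero (s := α + k) fun m hm => hα1 (k + m) (by push_cast; linarith)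
    rw [Gamma_add_natCast hα1] at h
    exact right_ne_zero_of_mul h
  rw [show 2 * (k : ℝ) + 2 * α = 2 * α + (2 * k : ℕ) by push_cast; ring, Gamma_add_natCast hα2,
    ascPochhammer_two_mul_eval, choose_add_sub_one_eq, factorial_two_mul, mul_div_mul_comm]
  field_simp

theorem abs_gegenbauer_eval_zero_of_odd (hα : α ∈ Ioo (-(1 / 2)) 0) {n : ℕ} (hn : Odd n) :
    |(gegenbauer α (n + 1)).eval 0| =
      ((n + 1).factorial : ℝ) * |Real.Gamma (2 * α)| / Real.Gamma (n + 2 * α + 1) *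
        |Ring.choose (((n : ℝ) + 1) / 2 + α - 1) ((n + 1) / 2)| := by
  obtain ⟨k, hk⟩ : ∃ k, n + 1 = 2 * k := even_iff_exists_two_mul.1 hn.add_one
  have hkn : (n : ℝ) + 1 = 2 * k := by exact_mod_cast hk
  have hk1 : (1 : ℝ) ≤ k := by exact_mod_cast (show 1 ≤ k by omega)
  have hΓ := Real.Gamma_pos_of_pos (show 0 < 2 * (k : ℝ) + 2 * α by linarith [hα.1])
  rw [hk, Nat.mul_div_cancel_left k two_pos, show (n : ℝ) + 2 * α + 1 = 2 * k + 2 * α by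
    linarith, hkn, mul_div_cancel_left₀ _ (two_ne_zero' ℝ), ← abs_abs ((gegenbauer _ _).eval _),
    abs_gegenbauer_eval_zero hα.1, ascPochhammer_half_div_eq_choose_sub_one hα, abs_mul, abs_div,
    abs_mul, Nat.abs_cast, abs_of_pos hΓ]

theorem errorRatio_mul_of_even (hα : α ∈ Ioo (-(1 / 2)) 0) {n : ℕ} (hn : Even n) :
    errorRatio α n * (((n : ℝ) + 1) * |(gegenbauer α n).eval 0| /
        √(((n : ℝ) + 1) * (n + 1 + 2 * α))) =
      |Real.Gamma α| * |α| / (√(((n : ℝ) + 1) * (2 * α + n + 1)) * Real.Gamma (n + α + 1)) *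
          |Ring.choose ((n : ℝ) / 2 + α) (n / 2)| := by
  obtain ⟨k, rfl⟩ : ∃ k, n = 2 * k := even_iff_exists_two_mul.1 hn
  have h1 : 0 < α + 1 := by linarith [hα.1]
  have hΓ := Real.Gamma_pos_of_pos h1
  have := ascPochhammer_pos (2 * k) _ h1
  have := ascPochhammer_pos (2 * k) _ (show 0 < 2 * α + 1 by linarith [hα.1])
  have hchoose : 0 < Ring.choose ((k : ℝ) + α) k := by
    rw [show (k : ℝ) + α = k + (α + 1) - 1 by ring, choose_add_sub_one_eq]
    exact div_pos (ascPochhammer_pos k _ h1) (by positivity)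
  have hG : |Real.Gamma α| * |α| = Real.Gamma (α + 1) := by
    rw [← abs_mul, mul_comm, ← Real.Gamma_add_one hα.2.ne, abs_of_pos hΓ]
  have hhalf : ((2 * k : ℕ) : ℝ) / 2 = k := by push_cast; ring
  rw [hG, hhalf, Nat.mul_div_cancel_left k two_pos, abs_of_pos hchoose,
    abs_gegenbauer_eval_zero hα.1, ascPochhammer_half_div_eq_choose hα.1,
    errorRatio_eq_ascPochhammer hα.1, Nat.factorial_succ, Nat.cast_mul, Nat.cast_add_one,
    show ((2 * k : ℕ) : ℝ) + α + 1 = α + 1 + (2 * k : ℕ) by ring,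
    Gamma_add_natCast (ne_neg_natCast_of_pos h1),
    show 2 * α + ((2 * k : ℕ) : ℝ) + 1 = (2 * k : ℕ) + 1 + 2 * α by ring]
  field_simp

end ClosedForms

/-! ### Asymptotics of the error constants -/

section Asymptotics

open Asymptotics Filter Topology

theorem GammaSeq_eq_div_ascPochhammer (z : ℝ) (n : ℕ) :
    Real.GammaSeq z n = (n : ℝ) ^ z * n.factorial / (ascPochhammer ℝ (n + 1)).eval z := by
  have hprod (m : ℕ) : ∏ j ∈ Finset.range m, (z + j) = (ascPochhammer ℝ m).eval z := by
    induction m with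
    | zero => simp
    | succ m ih => rw [Finset.prod_range_succ, ih, ascPochhammer_succ_eval]
  rw [Real.GammaSeq, hprod]

theorem isEquivalent_ascPochhammer {z : ℝ} (hz : ∀ m : ℕ, z ≠ -m) :
    (fun n : ℕ => (ascPochhammer ℝ n).eval z) ~[atTop]
      fun n : ℕ => (n : ℝ) ^ (z - 1) * (n.factorial : ℝ) / Real.Gamma z := by
  have hΓ := Real.Gamma_ne_zero hz
  have hlim : Tendsto (fun n : ℕ => Real.Gamma z / Real.GammaSeq z n * (n / (n + z))) atTop
      (𝓝 (1 * 1)) := by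
    have h := (tendsto_const_nhds (x := Real.Gamma z)).div (Real.GammaSeq_tendsto_Gamma z) hΓ
    rw [div_self hΓ] at h
    exact h.mul (tendsto_natCast_div_add_atTop z)
  rw [mul_one] at hlim
  refine isEquivalent_of_tendsto_one (hlim.congr' ?_)
  filter_upwards [eventually_gt_atTop 0] with n hn
  have hn' : (0 : ℝ) < n := by exact_mod_cast hn
  have hzn : (n : ℝ) + z ≠ 0 := fun h => hz n (by linarith)
  have := Real.rpow_pos_of_pos hn' z
  rw [Pi.div_apply, GammaSeq_eq_div_ascPochhammer, ascPochhammer_succ_eval, add_comm z,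
    Real.rpow_sub_one hn'.ne']
  field_simp

theorem isEquivalent_ascPochhammer_div {a b : ℝ} (ha : 0 < a) (hb : 0 < b) :
    (fun n : ℕ => (ascPochhammer ℝ n).eval a / (ascPochhammer ℝ n).eval b) ~[atTop]
      fun n : ℕ => Real.Gamma b / Real.Gamma a * (n : ℝ) ^ (a - b) := by
  refine ((isEquivalent_ascPochhammer (ne_neg_natCast_of_pos ha)).div
    (isEquivalent_ascPochhammer (ne_neg_natCast_of_pos hb))).congr_right ?_
  filter_upwards [eventually_gt_atTop 0] with n hn
  have hn' : (0 : ℝ) < n := by exact_mod_cast hn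
  have := Real.Gamma_pos_of_pos ha
  have := Real.Gamma_pos_of_pos hb
  rw [Pi.div_apply, show a - b = (a - 1) - (b - 1) by ring, Real.rpow_sub hn' (a - 1)]
  field_simp

theorem isBigO_gegenbauer_eval_zero {α : ℝ} (hα : -(1 / 2) < α) :
    (fun k : ℕ => (gegenbauer α (2 * k)).eval 0) =O[atTop] fun k : ℕ => (k : ℝ) ^ (-α) := by
  have h := (isEquivalent_ascPochhammer_div one_half_pos
    (show 0 < α + 1 / 2 by linarith)).isBigO
  rw [show 1 / 2 - (α + 1 / 2) = -α by ring] at h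
  refine IsBigO.of_abs_left ?_
  simp only [abs_gegenbauer_eval_zero hα]
  exact h.trans (isBigO_const_mul_self _ _ _)

theorem abs_gegenbauer_succ_mul_sqrt_le_of_even {α : ℝ} (hα : -(1 / 2) < α) (hα0 : α ≤ 0) {m : ℕ}
    (hm : Even m) {x : ℝ} (hx : |x| ≤ 1) :
    |(gegenbauer α (m + 1)).eval x| * √(1 + 2 * α) ≤ |(gegenbauer α m).eval 0| := by
  have hpos : 0 < ((m : ℝ) + 1) * (m + 1 + 2 * α) := by
    have : (0 : ℝ) ≤ m := m.cast_nonneg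
    exact mul_pos (by linarith) (by linarith)
  have hsqrt : ((m : ℝ) + 1) * √(1 + 2 * α) ≤ √(((m : ℝ) + 1) * (m + 1 + 2 * α)) := by
    refine Real.le_sqrt_of_sq_le ?_
    rw [mul_pow, Real.sq_sqrt (by linarith), sq, mul_assoc]
    have : (0 : ℝ) ≤ m := m.cast_nonneg
    gcongr
    nlinarith
  have hle : ((m : ℝ) + 1) * |(gegenbauer α m).eval 0| / √(((m : ℝ) + 1) * (m + 1 + 2 * α)) *
      √(1 + 2 * α) ≤ |(gegenbauer α m).eval 0| := by
    rw [div_mul_eq_mul_div, div_le_iff₀ (Real.sqrt_pos.2 hpos), mul_right_comm, mul_comm]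
    gcongr
  exact (mul_le_mul_of_nonneg_right (abs_gegenbauer_succ_le_of_even hα hα0 hm hx)
    (Real.sqrt_nonneg _)).trans hle

theorem exists_eventually_abs_gegenbauer_succ_le_of_nonpos {α : ℝ} (hα : -(1 / 2) < α)
    (hα0 : α ≤ 0) : ∃ D : ℝ, 0 < D ∧ ∀ᶠ n : ℕ in atTop, ∀ t : ℝ, |t| ≤ 1 →
      |(gegenbauer α (n + 1)).eval t| ≤ D * (n : ℝ) ^ (-α) := by
  obtain ⟨C, hC, hbound⟩ := (isBigO_gegenbauer_eval_zero hα).exists_pos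
  obtain ⟨K, hK⟩ := eventually_atTop.1 hbound.bound
  have hs : 0 < √(1 + 2 * α) := Real.sqrt_pos.2 (by linarith)
  have hs1 : √(1 + 2 * α) ≤ 1 := Real.sqrt_le_one.2 (by linarith)
  have hzero {k n : ℕ} (hk : K ≤ k) (hkn : k ≤ n) :
      |(gegenbauer α (2 * k)).eval 0| ≤ C * (n : ℝ) ^ (-α) := by
    refine (hK k hk).trans ?_
    rw [Real.norm_of_nonneg (by positivity)]
    have : 0 ≤ -α := neg_nonneg.2 hα0
    gcongr
  refine ⟨C / √(1 + 2 * α), by positivity, ?_⟩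
  filter_upwards [eventually_ge_atTop (2 * K)] with n hn t ht
  rw [div_mul_eq_mul_div, le_div_iff₀ hs]
  rcases n.even_or_odd' with ⟨k, rfl | rfl⟩
  · exact (abs_gegenbauer_succ_mul_sqrt_le_of_even hα hα0 (even_two_mul k) ht).trans
      (hzero (by omega) (by omega))
  · rw [show 2 * k + 1 + 1 = 2 * (k + 1) by ring]
    refine (mul_le_of_le_one_right (abs_nonneg _) hs1).trans
      ((abs_gegenbauer_le_of_even hα hα0 (even_two_mul _) ht).trans (hzero ?_ ?_)) <;> omega

theorem exists_eventually_abs_gegenbauer_succ_le {α : ℝ} (hα : -(1 / 2) < α) :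
    ∃ D : ℝ, 0 < D ∧ ∀ᶠ n : ℕ in atTop, ∀ t : ℝ, |t| ≤ 1 →
      |(gegenbauer α (n + 1)).eval t| ≤ D * (n : ℝ) ^ max 0 (-α) := by
  rcases le_total 0 α with h | h
  · refine ⟨1, one_pos, Eventually.of_forall fun n t ht => ?_⟩
    rw [max_eq_left (neg_nonpos.2 h), Real.rpow_zero, mul_one]
    exact abs_gegenbauer_le_one h (n + 1) ht
  · rw [max_eq_right (neg_nonneg.2 h)]
    exact exists_eventually_abs_gegenbauer_succ_le_of_nonpos hα h

theorem isBigO_inv_factorial_succ :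
    (fun n : ℕ => ((n + 1).factorial : ℝ)⁻¹) =O[atTop]
      fun n : ℕ => Real.exp n / (n : ℝ) ^ ((n : ℝ) + 3 / 2) := by
  refine IsBigO.of_bound 1 ?_
  filter_upwards [eventually_gt_atTop 0] with n hn
  have hn' : (0 : ℝ) < n := by exact_mod_cast hn
  have hstirling : (n : ℝ) ^ (n : ℝ) * √n / Real.exp n ≤ (n.factorial : ℝ) := by
    refine le_trans (le_of_eq ?_)
      ((mul_le_mul_of_nonneg_right (Real.sqrt_le_sqrt (x := n) ?_) (by positivity)).trans
        (Stirling.le_factorial_stirling n))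
    · rw [div_pow, ← Real.exp_nat_mul, mul_one, Real.rpow_natCast]
      ring
    · nlinarith [Real.pi_gt_three]
  have hpow : (n : ℝ) ^ ((n : ℝ) + 3 / 2) = n * ((n : ℝ) ^ (n : ℝ) * √n) := by
    rw [show (n : ℝ) + 3 / 2 = 1 + (n + 1 / 2) by ring, Real.rpow_add hn', Real.rpow_add hn',
      Real.rpow_one, Real.sqrt_eq_rpow]
  rw [one_mul, Real.norm_of_nonneg (by positivity), Real.norm_of_nonneg (by positivity),
    inv_le_comm₀ (by positivity) (by positivity), inv_div, hpow, mul_div_assoc,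
    Nat.factorial_succ, Nat.cast_mul]
  gcongr
  exact n.le_succ

theorem isBigO_errorRatio {α : ℝ} (hα : -(1 / 2) < α) :
    errorRatio α =O[atTop] fun n : ℕ => Real.exp n / (n : ℝ) ^ ((n : ℝ) + 3 / 2 - α) := by
  have hratio := (isEquivalent_ascPochhammer_div (show 0 < 2 * α + 1 by linarith)
    (show 0 < α + 1 by linarith)).isBigO.trans (isBigO_const_mul_self _ _ _)
  rw [show 2 * α + 1 - (α + 1) = α by ring] at hratio
  refine (hratio.mul isBigO_inv_factorial_succ).congr' (Eventually.of_forall fun n => ?_) ?_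
  · rw [errorRatio_eq_ascPochhammer hα, div_eq_mul_inv _ ((n + 1).factorial : ℝ)]
  · filter_upwards [eventually_gt_atTop 0] with n hn
    have hn' : (0 : ℝ) < n := by exact_mod_cast hn
    have := Real.rpow_pos_of_pos hn' α
    rw [Real.rpow_sub hn']
    field_simp

theorem exists_eventually_errorRatio_le {α : ℝ} (hα : -(1 / 2) < α) :
    ∃ D : ℝ, 0 < D ∧ ∀ᶠ n : ℕ in atTop,
      errorRatio α n ≤ D * (Real.exp n / (n : ℝ) ^ ((n : ℝ) + 3 / 2 - α)) := by
  obtain ⟨D, hD, h⟩ := (isBigO_errorRatio hα).exists_pos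
  refine ⟨D, hD, h.bound.mono fun n hn => (Real.le_norm_self _).trans (hn.trans_eq ?_)⟩
  rw [Real.norm_of_nonneg (by positivity)]

end Asymptotics

theorem rpow_neg_two_mul_natCast_sub_one {x : ℝ} (hx : 0 ≤ x) (n : ℕ) :
    x ^ (-2 * (n : ℝ) - 1) = (x ^ (2 * n + 1))⁻¹ := by
  rw [show -2 * (n : ℝ) - 1 = -((2 * n + 1 : ℕ) : ℝ) by push_cast; ring, Real.rpow_neg hx,
    Real.rpow_natCast]

end BSGQ

end

theorem mainTheorem4 (α : ℝ) (hα : -(1 / 2) < α) :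
    ∃ D₁ D₂ : ℝ, 0 < D₁ ∧ 0 < D₂ ∧ ∃ N : ℕ,
      ∀ (l : ℝ) (_ : 0 < l) (n q : ℕ) (_ : 1 ≤ q) (f : ℝ → ℝ)
        (_ : ContDiffOn ℝ ((n + 1 : ℕ) : WithTop ℕ∞) f (Set.Icc 0 l))
        (i : Fin (n + 1)) (A : ℝ) (_ : 0 < A)
        (_ : ∀ x ∈ Set.Ioo 0 l,
          |iteratedDerivWithin (n + 1)
            (fun y => (BSGQ.node α l n i - y) ^ (q - 1) * f y) (Set.Icc 0 l) x| ≤ A),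
        (0 ≤ α →
          |BSGQ.truncError α l n q f i| ≤
            A * (2 : ℝ) ^ (-2 * (n : ℝ) - 1) * Real.Gamma (α + 1) * BSGQ.node α l n i *
                l ^ (n + 1) * Real.Gamma (n + 2 * α + 1) /
              ((Nat.factorial (q - 1) : ℝ) * Real.Gamma (2 * α + 1) * Real.Gamma (n + 2) *
                Real.Gamma (n + α + 1))) ∧
        (α < 0 → Odd n →
          |BSGQ.truncError α l n q f i| ≤
            A * (2 : ℝ) ^ (-2 * (n : ℝ) - 1) * Real.Gamma (α + 1) * BSGQ.node α l n i *
                l ^ (n + 1) * Real.Gamma (n + 2 * α + 1) /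
              ((Nat.factorial (q - 1) : ℝ) * Real.Gamma (2 * α + 1) * Real.Gamma (n + 2) *
                Real.Gamma (n + α + 1)) *
            ((Nat.factorial (n + 1) : ℝ) * |Real.Gamma (2 * α)| / Real.Gamma (n + 2 * α + 1) *
              |Ring.choose (((n : ℝ) + 1) / 2 + α - 1) ((n + 1) / 2)|)) ∧
        (α < 0 → Even n →
          |BSGQ.truncError α l n q f i| <
            A * (2 : ℝ) ^ (-2 * (n : ℝ) - 1) * |Real.Gamma α| * |α| * BSGQ.node α l n i *
                l ^ (n + 1) /
              ((Nat.factorial (q - 1) : ℝ) * Real.sqrt (((n : ℝ) + 1) * (2 * α + n + 1)) *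
                Real.Gamma (n + α + 1)) *
            |Ring.choose ((n : ℝ) / 2 + α) (n / 2)|) ∧
        (0 ≤ α → N ≤ n →
          |BSGQ.truncError α l n q f i| ≤
            A * D₁ * (Real.exp n * l ^ (n + 1) * BSGQ.node α l n i /
              ((2 : ℝ) ^ (2 * n + 1) * (n : ℝ) ^ ((n : ℝ) + 3 / 2 - α) *
                (Nat.factorial (q - 1) : ℝ)))) ∧
        (α < 0 → N ≤ n →
          |BSGQ.truncError α l n q f i| ≤
            A * D₁ * D₂ * (Real.exp n * l ^ (n + 1) * BSGQ.node α l n i /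
              ((2 : ℝ) ^ (2 * n + 1) * (n : ℝ) ^ ((n : ℝ) + 3 / 2) *
                (Nat.factorial (q - 1) : ℝ)))) := by
  obtain ⟨D₁, hD₁, h₁⟩ := BSGQ.exists_eventually_errorRatio_le hα
  obtain ⟨D₂, hD₂, h₂⟩ := BSGQ.exists_eventually_abs_gegenbauer_succ_le hα
  obtain ⟨N, hN⟩ := Filter.eventually_atTop.1 (h₁.and (h₂.and (Filter.eventually_gt_atTop 0)))
  refine ⟨D₁, D₂, hD₁, hD₂, N, fun l hl n q hq f hf i A hA0 hA => ?_⟩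
  have key {M : ℝ} := BSGQ.abs_truncError_lt (M := M) hα hl hq hf hA0 hA
  have hx := (BSGQ.node_mem_Ioo hα hl n i).1
  have h2 := BSGQ.rpow_neg_two_mul_natCast_sub_one two_pos.le n
  refine ⟨fun h0 => ?_, fun h0 hn => ?_, fun h0 hn => ?_, fun h0 hn => ?_, fun h0 hn => ?_⟩
  · refine (key fun t ht => BSGQ.abs_gegenbauer_le_one h0 (n + 1) ht).le.trans_eq ?_
    rw [h2, BSGQ.errorRatio]
    ring
  · refine (key fun t ht => BSGQ.abs_gegenbauer_le_of_even hα h0.le hn.add_one ht).le.trans_eq ?_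
    rw [h2, BSGQ.abs_gegenbauer_eval_zero_of_odd ⟨hα, h0⟩ hn, BSGQ.errorRatio]
    ring
  · refine (key fun t ht => BSGQ.abs_gegenbauer_succ_le_of_even hα h0.le hn ht).trans_eq ?_
    rw [h2, BSGQ.errorRatio_mul_of_even ⟨hα, h0⟩ hn]
    ring
  · grw [key fun t ht => BSGQ.abs_gegenbauer_le_one h0 (n + 1) ht, (hN n hn).1]
    exact le_of_eq (by ring)
  · obtain ⟨hr, hG, hn0⟩ := hN n hn
    rw [max_eq_right (neg_pos.2 h0).le] at hG
    grw [key hG, hr, sub_eq_add_neg, Real.rpow_add (Nat.cast_pos.2 hn0)]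
    exact le_of_eq (by field_simp)
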